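/- Conventions. An algebra is a nonempty set equipped with finitary basic operations (constants, i.e. operations of arity $0$, are allowed), and its type is the family of its operation symbols with their arities; the type is finite if there are finitely many operation symbols. Let $\mathsf{V}$ be a variety of a fixed finite type, that is, a class of algebras of this type axiomatized by a set of equations. It is finitely axiomatizable if it is the class of all models of some finite set of first-order sentences, and locally finite if, for every $A \in \mathsf{V}$, every finite subset of $A$ generates a finite subuniverse of $A$. The free algebra $\boldsymbol{F}_{\mathsf{V}}(\aleph_0)$ is the quotient of the algebra of terms in the variables $x_0, x_1, x_2, \dots$ by the congruence $\{\langle t, s\rangle : \mathsf{V} \vDash t \approx s\}$. A universal sentence is a first-order sentence of the form $\forall x_1 \cdots \forall x_n\, P$ with $P$ quantifier-free, and $\mathsf{Th}_\forall(\boldsymbol{F}_{\mathsf{V}}(\aleph_0))$ is the set of universal sentences valid in $\boldsymbol{F}_{\mathsf{V}}(\aleph_0)$. Sentences are identified with natural numbers by a standard Gödel numbering. A set $T$ of sentences is decidable if the set of Gödel numbers of its members is recursive, and it is recursively axiomatizable if there is a decidable set of first-order sentences (of the given type) that has exactly the same models as $T$. Theorem. Let $\mathsf{V}$ be a finitely axiomatizable,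 locally finite variety of finite type. If $\mathsf{Th}_\forall(\boldsymbol{F}_{\mathsf{V}}(\aleph_0))$ is recursively axiomatizable, then it is decidable. -/

import Mathlib

namespace UnivAlg

open FirstOrder

/-- An algebra of type `L`: a nonempty set with an interpretation of the symbols of `L`. -/
structure Alg (L : FirstOrder.Language.{0, 0}) where
  carrier : Type
  [nonempty : Nonempty carrier]
  [str : L.Structure carrier]

attribute [instance] Alg.nonempty Alg.str

section Classes

variable {L : FirstOrder.Language.{0, 0}}

/-- The algebra `A` satisfies the equation `t ≈ s`. -/
def Alg.SatEq (A : Alg L) {α : Type} (t s : L.Term α) : Prop :=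
  ∀ v : α → A.carrier, t.realize v = s.realize v

/-- The class of models of a set of first-order sentences. -/
def modelClass (T : Set L.Sentence) : Set (Alg L) :=
  {A | ∀ φ ∈ T, A.carrier ⊨ φ}

/-- A variety is a class of algebras axiomatized by a set of equations. -/
def IsVariety (V : Set (Alg L)) : Prop :=
  ∃ E : Set (L.Term ℕ × L.Term ℕ), V = {A | ∀ p ∈ E, A.SatEq p.1 p.2}

/-- A class is finitely axiomatizable when it is the class of models of a finite set of
first-order sentences. -/
def FinitelyAxiomatizable (V : Set (Alg L)) : Prop :=
  ∃ T : Set L.Sentence, T.Finite ∧ modelClass T = V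

/-- A class is locally finite when finitely generated subuniverses of its members are finite. -/
def LocallyFinite (V : Set (Alg L)) : Prop :=
  ∀ A ∈ V, ∀ X : Set A.carrier, X.Finite → (FirstOrder.Language.Substructure.closure L X : Set A.carrier).Finite

/-- The universal theory of a class `K`: the universal sentences valid in all members of `K`. -/
def univTheory (K : Set (Alg L)) : Set L.Sentence :=
  {φ | φ.IsUniversal ∧ ∀ A ∈ K, A.carrier ⊨ φ}

end Classes

section Free

variable {L : FirstOrder.Language.{0, 0}} [L.IsAlgebraic]

/-- The term algebra over the set of variables `α`. -/
instance termStructure (α : Type) : L.Structure (L.Term α) where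
  funMap f ts := FirstOrder.Language.Term.func f ts
  RelMap r _ := isEmptyElim r

/-- The relation `V ⊨ t ≈ s` on terms with variables in `α`. -/
def freeSetoid (V : Set (Alg L)) (α : Type) : Setoid (L.Term α) where
  r t s := ∀ A ∈ V, A.SatEq t s
  iseqv :=
    { refl := fun _ _ _ _ => rfl
      symm := fun h A hA v => (h A hA v).symm
      trans := fun h k A hA v => (h A hA v).trans (k A hA v) }

/-- The relation `V ⊨ t ≈ s` is a congruence of the term algebra. -/
instance freePrestructure (V : Set (Alg L)) (α : Type) : L.Prestructure (freeSetoid V α) where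
  toStructure := termStructure α
  fun_equiv := by
    intro n f x y h A hA v
    exact congrArg (FirstOrder.Language.Structure.funMap f) (funext fun i => h i A hA v)
  rel_equiv := by
    intro n r
    exact isEmptyElim r

/-- The free algebra of `V` over the set of free generators `α`: the quotient of the term algebra
by the congruence `V ⊨ t ≈ s`. -/
def freeAlg (V : Set (Alg L)) (α : Type) [Nonempty α] : Alg L where
  carrier := Quotient (freeSetoid V α)
  nonempty := ⟨Quotient.mk _ (FirstOrder.Language.Term.var (Classical.arbitrary α))⟩
  str := inferInstance

end Free

section Coding

variable {L : FirstOrder.Language.{0, 0}}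

/-- The Gödel number of a term in the variables `x_0, …, x_(n-1)`, relative to a numbering `e` of
the basic operation symbols. -/
def termCode (e : (Σ n, L.Functions n) ↪ ℕ) {n : ℕ} : L.Term (Empty ⊕ Fin n) → ℕ
  | .var (Sum.inl z) => z.elim
  | .var (Sum.inr i) => Nat.pair 0 i
  | .func f ts =>
      Nat.pair (e ⟨_, f⟩ + 1) (Encodable.encode (List.ofFn fun i => termCode e (ts i)))

theorem termCode_injective (e : (Σ n, L.Functions n) ↪ ℕ) {n : ℕ} :
    Function.Injective (termCode e (n := n)) := by
  intro t
  induction t with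
  | var a =>
    rcases a with z | i
    · exact z.elim
    · intro s h
      rcases s with (z | j) | ⟨g, ss⟩
      · exact z.elim
      · simpa [termCode, Fin.val_inj] using h
      · simp [termCode] at h
  | func f ts ih =>
    intro s h
    rcases s with (z | j) | ⟨g, ss⟩
    · exact z.elim
    · simp [termCode] at h
    · simp only [termCode, Nat.pair_eq_pair, add_left_inj, EmbeddingLike.apply_eq_iff_eq] at h
      obtain ⟨h1, h2⟩ := h
      cases h1
      have h3 := List.ofFn_injective (Encodable.encode_injective h2)
      congr 1
      funext i
      exact ih i (congrFun h3 i)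

variable [L.IsAlgebraic]

/-- The Gödel number of a first-order formula, relative to a numbering `e` of the basic operation
symbols. The primitive symbols are falsum, equality, implication and the universal quantifier;
the outermost quantifier of a sentence binds `x_0`, the next one `x_1`, and so on. -/
def formulaCode (e : (Σ n, L.Functions n) ↪ ℕ) : {n : ℕ} → L.BoundedFormula Empty n → ℕ
  | _, .falsum => Nat.pair 0 0
  | _, .equal t s => Nat.pair 1 (Nat.pair (termCode e t) (termCode e s))
  | _, .rel r _ => isEmptyElim r
  | _, .imp φ ψ => Nat.pair 2 (Nat.pair (formulaCode e φ) (formulaCode e ψ))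
  | _, .all φ => Nat.pair 3 (formulaCode e φ)

theorem formulaCode_injective (e : (Σ n, L.Functions n) ↪ ℕ) {n : ℕ} :
    Function.Injective (formulaCode e (n := n)) := by
  intro φ
  induction φ with
  | falsum => 
    intro ψ h
    cases ψ <;> first
      | rfl
      | (simp [formulaCode] at h; done)
      | exact isEmptyElim ‹L.Relations _›
  | equal t s =>
    intro ψ h
    cases ψ <;> simp [formulaCode] at h
    · rw [termCode_injective e h.1, termCode_injective e h.2]
    · exact isEmptyElim ‹L.Relations _›
  | rel r _ => exact isEmptyElim r
  | imp φ ψ ih1 ih2 =>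
    intro χ h
    cases χ <;> simp [formulaCode] at h
    · exact isEmptyElim ‹L.Relations _›
    · rw [ih1 h.1, ih2 h.2]
  | all φ ih =>
    intro χ h
    cases χ <;> simp [formulaCode] at h
    · exact isEmptyElim ‹L.Relations _›
    · rw [ih h]

/-- A set of sentences is decidable (recursive) when the set of Gödel numbers of its members is
recursive. -/
def DecidableSet (e : (Σ n, L.Functions n) ↪ ℕ) (T : Set L.Sentence) : Prop :=
  ComputablePred fun m : ℕ => ∃ φ ∈ T, formulaCode e φ = m

/-- A set of sentences `T` is recursively axiomatizable when some recursive set of first-order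
sentences has the same models as `T`. -/
def RecursivelyAxiomatizable (e : (Σ n, L.Functions n) ↪ ℕ) (T : Set L.Sentence) : Prop :=
  ∃ S : Set L.Sentence, DecidableSet e S ∧ modelClass S = modelClass T

end Coding

end UnivAlg

/-!
Write `F` for the free algebra of `V` over `ℕ`. By Post's theorem it suffices that membership in the
universal theory of `F` and its negation are both `Σ₁`, that is, projections of primitive recursive
relations. No deductive calculus for first-order logic is needed: apart from equational logic,
everything is reduced to evaluating sentences in finite algebras, which is primitive recursive
(`primrec_satCode`).

By compactness `V` has a finite equational basis (`exists_finite_basis`), so validity of an equation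
in `V` is `Σ₁`: it amounts to derivability in equational logic (`isSigmaOne_eqDerivable`,
`eqDerivable_varTermCode_iff`). Consequently the algebra of `V` free on `n + 1` generators, which is
finite because `V` is locally finite, can be recognized by a `Σ₁` condition: it is a finite algebra
in `V` whose elements are values of terms and whose operation tables, read as equations between
these terms, are valid in `V` (`IsPresentation`, `isSigmaOne_isPresentation`,
`exists_isPresentation`).

A universal sentence fails in `F` exactly if it fails in one of these algebras; this is `Σ₁`
(`notMem_univTheory_code_iff`).

For the converse let `S` be a recursive set of axioms for the universal theory of `F`. If a
universal sentence `φ` with at most `n` quantifiers fails in `F`, then it fails in a subalgebra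
generated by `n + 1` elements. Such a subalgebra is a model of `S`, and it has no more elements than
the free algebra of rank `n + 1`, a bound on its size found by searching for a presentation. So `φ`
holds in `F` exactly if each of the finitely many algebras within this bound satisfies `φ` or
violates some sentence of `S`, which again is a `Σ₁` condition (`mem_univTheory_code_iff`).
-/

namespace UnivAlg

open FirstOrder

/-! ### `Σ₁` predicates and derivations -/

section SigmaOne

variable {α β : Type} [Primcodable α] [Primcodable β]

/-- A predicate is `Σ₁` when it is the projection of a primitive recursive relation. -/
def IsSigmaOne (p : α → Prop) : Prop :=
  ∃ q : α → ℕ → Bool, Primrec₂ q ∧ ∀ x, p x ↔ ∃ k, q x k = true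

/-- Primitive recursive predicates are closed under universal quantification over a list that
depends primitively recursively on the argument. -/
theorem primrecPred_forall_mem {l : α → List β} (hl : Primrec l) {R : α → β → Prop}
    (hR : PrimrecPred fun z : α × β => R z.1 z.2) : PrimrecPred fun x => ∀ y ∈ l x, R x y := by
  have h1 : PrimrecRel fun (y : β) (x : α) => R x y :=
    PrimrecPred.comp (f := fun z : β × α => (z.2, z.1)) hR (Primrec.pair Primrec.snd Primrec.fst)
  exact PrimrecRel.comp (g := fun x : α => x) h1.forall_mem_list hl Primrec.id

theorem primrecPred_exists_mem {l : α → List β} (hl : Primrec l) {R : α → β → Prop}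
    (hR : PrimrecPred fun z : α × β => R z.1 z.2) : PrimrecPred fun x => ∃ y ∈ l x, R x y :=
  (primrecPred_forall_mem hl (R := fun x y => ¬ R x y) hR.not).not.of_eq fun x => by simp

theorem primrecRel_mem : PrimrecRel fun (y : β) (l : List β) => y ∈ l := by
  have : PrimrecPred fun z : β × List β => ∃ a ∈ z.2, a = z.1 :=
    primrecPred_exists_mem (R := fun (z : β × List β) a => a = z.1) Primrec.snd
      (Primrec.eq.comp Primrec.snd (Primrec.fst.comp Primrec.fst))
  exact this.of_eq fun z => by simp

namespace IsSigmaOne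

theorem of_eq {p q : α → Prop} (hp : IsSigmaOne p) (h : ∀ x, p x ↔ q x) : IsSigmaOne q :=
  (funext fun x => propext (h x) : p = q) ▸ hp

theorem of_primrecPred {p : α → Prop} (hp : PrimrecPred p) : IsSigmaOne p := by
  obtain ⟨hd, hp⟩ := hp
  exact ⟨fun x _ => decide (p x), hp.comp Primrec.fst, by simp⟩

theorem comp {p : β → Prop} (hp : IsSigmaOne p) {f : α → β} (hf : Primrec f) :
    IsSigmaOne fun x => p (f x) := by
  obtain ⟨q, hq, h⟩ := hp
  exact ⟨fun x k => q (f x) k, hq.comp (hf.comp Primrec.fst) Primrec.snd, fun x => h _⟩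

theorem and {p q : α → Prop} (hp : IsSigmaOne p) (hq : IsSigmaOne q) :
    IsSigmaOne fun x => p x ∧ q x := by
  obtain ⟨p', hp', h⟩ := hp
  obtain ⟨q', hq', h'⟩ := hq
  refine ⟨fun x k => p' x k.unpair.1 && q' x k.unpair.2,
    Primrec.and.comp
      (hp'.comp Primrec.fst (Primrec.fst.comp (Primrec.unpair.comp Primrec.snd)))
      (hq'.comp Primrec.fst (Primrec.snd.comp (Primrec.unpair.comp Primrec.snd))), fun x => ?_⟩
  refine (and_congr (h x) (h' x)).trans ?_
  constructor
  · rintro ⟨⟨a, ha⟩, b, hb⟩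
    exact ⟨Nat.pair a b, by simp [ha, hb]⟩
  · rintro ⟨k, hk⟩
    rw [Bool.and_eq_true] at hk
    exact ⟨⟨_, hk.1⟩, _, hk.2⟩

theorem or {p q : α → Prop} (hp : IsSigmaOne p) (hq : IsSigmaOne q) :
    IsSigmaOne fun x => p x ∨ q x := by
  obtain ⟨p', hp', h⟩ := hp
  obtain ⟨q', hq', h'⟩ := hq
  refine ⟨fun x k => p' x k || q' x k, Primrec.or.comp hp' hq', fun x => ?_⟩
  simp only [h, h', Bool.or_eq_true, exists_or]

theorem ex {R : α → β → Prop} (hR : IsSigmaOne fun x : α × β => R x.1 x.2) :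
    IsSigmaOne fun x => ∃ y, R x y := by
  obtain ⟨q, hq, h⟩ := hR
  refine ⟨fun x k => ((Encodable.decode (α := β × ℕ) k).map
    fun yk => q (x, yk.1) yk.2).getD false, ?_, fun x => ?_⟩
  · refine Primrec.option_getD.comp (Primrec.option_map (Primrec.decode.comp Primrec.snd) ?_)
      (Primrec.const false)
    exact hq.comp (Primrec.pair (Primrec.fst.comp Primrec.fst) (Primrec.fst.comp Primrec.snd))
      (Primrec.snd.comp Primrec.snd)
  · constructor
    · rintro ⟨y, hy⟩
      obtain ⟨k, hk⟩ := (h (x, y)).1 hy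
      exact ⟨Encodable.encode (y, k), by simpa using hk⟩
    · rintro ⟨k, hk⟩
      cases hd : Encodable.decode (α := β × ℕ) k with
      | none => simp [hd] at hk
      | some yk =>
        exact ⟨yk.1, (h (x, yk.1)).2 ⟨yk.2, by simpa [hd] using hk⟩⟩

/-- A bounded universal quantifier costs nothing: one number bounds the witnesses of all
instances. -/
theorem ball {R : α → β → Prop} (hR : IsSigmaOne fun x : α × β => R x.1 x.2) {l : α → List β}
    (hl : Primrec l) : IsSigmaOne fun x => ∀ y ∈ l x, R x y := by
  classical
  obtain ⟨q, hq, h⟩ := hR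
  refine ⟨fun x k => decide (∀ y ∈ l x, ∃ k' ∈ List.range k, q (x, y) k' = true), ?_,
    fun x => ?_⟩
  · have h1 : PrimrecPred fun w : ((α × ℕ) × β) × ℕ => q (w.1.1.1, w.1.2) w.2 = true :=
      Primrec.eq.comp (hq.comp (Primrec.pair
        (Primrec.fst.comp (Primrec.fst.comp Primrec.fst)) (Primrec.snd.comp Primrec.fst))
        Primrec.snd) (Primrec.const true)
    have h2 := primrecPred_exists_mem
      (R := fun (w : (α × ℕ) × β) k' => q (w.1.1, w.2) k' = true)
      (Primrec.list_range.comp (Primrec.snd.comp Primrec.fst)) h1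
    exact (primrecPred_forall_mem (l := fun w : α × ℕ => l w.1)
      (R := fun w y => ∃ k' ∈ List.range w.2, q (w.1, y) k' = true)
      (hl.comp Primrec.fst) h2).decide
  · have h' : ∀ y, R x y ↔ ∃ k, q (x, y) k = true := fun y => h (x, y)
    simp only [decide_eq_true_eq, h', List.mem_range]
    generalize l x = L
    induction L with
    | nil => simp
    | cons y L ih =>
      simp only [List.forall_mem_cons, ih]
      constructor
      · rintro ⟨⟨k₁, h₁⟩, k₂, h₂⟩
        refine ⟨max (k₁ + 1) k₂, ⟨k₁, by omega, h₁⟩, fun z hz => ?_⟩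
        obtain ⟨k', hk', h'⟩ := h₂ z hz
        exact ⟨k', by omega, h'⟩
      · rintro ⟨k, ⟨k', -, h'⟩, h₂⟩
        exact ⟨⟨k', h'⟩, k, h₂⟩

theorem ball_lt {R : α → ℕ → Prop} (hR : IsSigmaOne fun x : α × ℕ => R x.1 x.2) {f : α → ℕ}
    (hf : Primrec f) : IsSigmaOne fun x => ∀ y < f x, R x y :=
  (ball hR (Primrec.list_range.comp hf)).of_eq fun x => by simp

theorem rePred {p : α → Prop} (hp : IsSigmaOne p) : REPred p := by
  obtain ⟨q, hq, h⟩ := hp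
  have : Partrec fun x => Nat.rfind fun k => Part.some (q x k) :=
    Partrec.rfind hq.to_comp.partrec₂
  refine this.dom_re.of_eq fun x => ?_
  refine Nat.rfind_dom.trans (Iff.trans ?_ (h x).symm)
  simp

/-- By Kleene's normal form: `x` satisfies `p` when some bounded computation halts on `x`. -/
theorem of_computablePred {p : ℕ → Prop} (hp : ComputablePred p) : IsSigmaOne p := by
  obtain ⟨c, hc⟩ := Nat.Partrec.Code.exists_code.1
    (Partrec.nat_iff.1 (hp.to_re.map (Computable.const 0).to₂))
  refine ⟨fun x k => (Nat.Partrec.Code.evaln k c x).isSome, ?_, fun x => ?_⟩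
  · exact Primrec.option_isSome.comp (Nat.Partrec.Code.primrec_evaln.comp
      (Primrec.pair (Primrec.pair Primrec.snd (Primrec.const c)) Primrec.fst))
  · have h1 : p x ↔ (Nat.Partrec.Code.eval c x).Dom := by
      rw [hc]; simp [Part.assert]
    rw [h1, Part.dom_iff_mem]
    simp only [Nat.Partrec.Code.evaln_complete, Option.isSome_iff_exists]
    exact exists_comm

end IsSigmaOne

end SigmaOne

section Derivations

variable {β : Type}

/-- The set inductively generated by the rules `rule w l y`, read as "the premises `l` yield `y`";
the number `w` stands for side information. -/
inductive Derivable (rule : ℕ → List β → β → Prop) : β → Prop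
  | intro (w : ℕ) (l : List β) (y : β) (h : rule w l y) (hl : ∀ z ∈ l, Derivable rule z) :
      Derivable rule y

open Classical in
/-- The elements derived by a list of attempted rule applications, the last entry being tried
first; applications that are not correct are skipped. -/
noncomputable def derivedList (rule : ℕ → List β → β → Prop) (d : List (ℕ × List β × β)) :
    List β :=
  d.foldr (fun s acc => if rule s.1 s.2.1 s.2.2 ∧ ∀ z ∈ s.2.1, z ∈ acc then s.2.2 :: acc else acc)
    []

theorem derivedList_sound {rule : ℕ → List β → β → Prop} {d : List (ℕ × List β × β)} :
    ∀ y ∈ derivedList rule d, Derivable rule y := by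
  classical
  induction d with
  | nil => simp [derivedList]
  | cons s d ih =>
    intro y hy
    change y ∈ (if rule s.1 s.2.1 s.2.2 ∧ ∀ z ∈ s.2.1, z ∈ derivedList rule d then
      s.2.2 :: derivedList rule d else derivedList rule d) at hy
    split_ifs at hy with h
    · rcases List.mem_cons.1 hy with rfl | hy
      · exact ⟨_, _, _, h.1, fun z hz => ih z (h.2 z hz)⟩
      · exact ih y hy
    · exact ih y hy

/-- Concatenating two lists of rule applications keeps the elements derived by either of them. -/
theorem derivedList_append {rule : ℕ → List β → β → Prop} (d d' : List (ℕ × List β × β)) :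
    derivedList rule d ⊆ derivedList rule (d ++ d') ∧
      derivedList rule d' ⊆ derivedList rule (d ++ d') := by
  classical
  induction d with
  | nil => simp [derivedList]
  | cons s d ih =>
    change (if rule s.1 s.2.1 s.2.2 ∧ ∀ z ∈ s.2.1, z ∈ derivedList rule d then
        s.2.2 :: derivedList rule d else derivedList rule d) ⊆
      (if rule s.1 s.2.1 s.2.2 ∧ ∀ z ∈ s.2.1, z ∈ derivedList rule (d ++ d') then
        s.2.2 :: derivedList rule (d ++ d') else derivedList rule (d ++ d')) ∧
      derivedList rule d' ⊆
      (if rule s.1 s.2.1 s.2.2 ∧ ∀ z ∈ s.2.1, z ∈ derivedList rule (d ++ d') then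
        s.2.2 :: derivedList rule (d ++ d') else derivedList rule (d ++ d'))
    by_cases h : rule s.1 s.2.1 s.2.2 ∧ ∀ z ∈ s.2.1, z ∈ derivedList rule d
    · have h' : rule s.1 s.2.1 s.2.2 ∧ ∀ z ∈ s.2.1, z ∈ derivedList rule (d ++ d') :=
        ⟨h.1, fun z hz => ih.1 (h.2 z hz)⟩
      rw [if_pos h, if_pos h']
      exact ⟨List.cons_subset_cons _ ih.1, List.subset_cons_of_subset _ ih.2⟩
    · rw [if_neg h]
      split_ifs
      · exact ⟨List.subset_cons_of_subset _ ih.1, List.subset_cons_of_subset _ ih.2⟩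
      · exact ih

theorem exists_derivedList {rule : ℕ → List β → β → Prop} {y : β} (hy : Derivable rule y) :
    ∃ d, y ∈ derivedList rule d := by
  classical
  induction hy with
  | intro w l y h hl ih =>
    have key : ∃ d, ∀ z ∈ l, z ∈ derivedList rule d := by
      clear h hl
      induction l with
      | nil => exact ⟨[], by simp⟩
      | cons x l ihl =>
        obtain ⟨d₁, h₁⟩ := ih x (by simp)
        obtain ⟨d₂, h₂⟩ := ihl fun z hz => ih z (by simp [hz])
        refine ⟨d₁ ++ d₂, List.forall_mem_cons.2 ⟨(derivedList_append d₁ d₂).1 h₁, fun z hz =>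
          (derivedList_append d₁ d₂).2 (h₂ z hz)⟩⟩
    obtain ⟨d, hd⟩ := key
    refine ⟨(w, l, y) :: d, ?_⟩
    change y ∈ if rule w l y ∧ ∀ z ∈ l, z ∈ derivedList rule d then
      y :: derivedList rule d else derivedList rule d
    rw [if_pos ⟨h, hd⟩]
    simp

/-- A set generated by a primitive recursive set of rules is `Σ₁`, the witness being a list of rule
applications. -/
theorem IsSigmaOne.derivable [Primcodable β] {rule : ℕ → List β → β → Prop}
    (h : PrimrecPred fun s : ℕ × List β × β => rule s.1 s.2.1 s.2.2) :
    IsSigmaOne (Derivable rule) := by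
  classical
  have h1 : PrimrecPred fun t : List (ℕ × List β × β) × (ℕ × List β × β) × List β =>
      rule t.2.1.1 t.2.1.2.1 t.2.1.2.2 := h.comp (Primrec.fst.comp Primrec.snd)
  have h2 : PrimrecPred fun t : List (ℕ × List β × β) × (ℕ × List β × β) × List β =>
      ∀ z ∈ t.2.1.2.1, z ∈ t.2.2 :=
    primrecPred_forall_mem
      (R := fun (t : List (ℕ × List β × β) × (ℕ × List β × β) × List β) z => z ∈ t.2.2)
      (Primrec.fst.comp (Primrec.snd.comp (Primrec.fst.comp Primrec.snd)))
      (primrecRel_mem.comp Primrec.snd (Primrec.snd.comp (Primrec.snd.comp Primrec.fst)))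
  have h3 : Primrec₂ fun (_ : List (ℕ × List β × β)) (t : (ℕ × List β × β) × List β) =>
      if rule t.1.1 t.1.2.1 t.1.2.2 ∧ ∀ z ∈ t.1.2.1, z ∈ t.2 then t.1.2.2 :: t.2 else t.2 :=
    Primrec.ite (h1.and h2) (Primrec.list_cons.comp
      (Primrec.snd.comp (Primrec.snd.comp (Primrec.fst.comp Primrec.snd)))
      (Primrec.snd.comp Primrec.snd)) (Primrec.snd.comp Primrec.snd)
  have hlist : Primrec (derivedList rule) :=
    (Primrec.list_foldr Primrec.id (Primrec.const []) h3).of_eq fun d => by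
      unfold derivedList
      congr!
  have : IsSigmaOne fun y => ∃ d, y ∈ derivedList rule d :=
    IsSigmaOne.ex (of_primrecPred (primrecRel_mem.comp Primrec.fst (hlist.comp Primrec.snd)))
  exact this.of_eq fun y => ⟨fun ⟨_, hd⟩ => derivedList_sound y hd, exists_derivedList⟩

end Derivations

/-! ### Finite algebras and formulas as numbers -/

section CodedAlgebras

theorem lt_encode_of_mem {l : List ℕ} {x : ℕ} (hx : x ∈ l) : x < Encodable.encode l := by
  induction l with
  | nil => simp at hx
  | cons y l ih =>
    rw [Encodable.encode_list_cons, Nat.lt_succ_iff]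
    rcases List.mem_cons.1 hx with rfl | hx
    · exact Nat.left_le_pair _ _
    · exact (ih hx).le.trans (Nat.right_le_pair _ _)

/-- The list of natural numbers with a given code. -/
def decodeList (b : ℕ) : List ℕ := Denumerable.ofNat (List ℕ) b

@[simp] theorem decodeList_encode (l : List ℕ) : decodeList (Encodable.encode l) = l :=
  Denumerable.ofNat_encode l

@[simp] theorem encode_decodeList (b : ℕ) : Encodable.encode (decodeList b) = b :=
  Denumerable.encode_ofNat b

theorem lt_of_mem_decodeList {b x : ℕ} (hx : x ∈ decodeList b) : x < b := by
  simpa using lt_encode_of_mem hx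

theorem primrec_decodeList : Primrec decodeList := Primrec.ofNat _

theorem primrec_all : Primrec fun l : List Bool => l.all id :=
  (primrecPred_forall_mem (R := fun (_ : List Bool) v => v = true) Primrec.id
    (Primrec.eq.comp Primrec.snd (Primrec.const true))).decide.of_eq fun l => by
      rw [Bool.eq_iff_iff]; simp

theorem unpair_snd_lt {c : ℕ} (h : c.unpair.1 ≠ 0) : c.unpair.2 < c := by
  have := Nat.add_le_pair c.unpair.1 c.unpair.2
  rw [Nat.pair_unpair] at this
  omega

/-- Every number `a = ⟨N, t⟩` is read as an algebra on `{0, …, N}`: the value of the `i`-th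
operation at `xs` is the digit of `t` in base `N + 1` at the position `⟨i, xs⟩`. -/
def tableOp (a i : ℕ) (xs : List ℕ) : ℕ :=
  a.unpair.2 / (a.unpair.1 + 1) ^ Nat.pair i (Encodable.encode xs) % (a.unpair.1 + 1)

theorem tableOp_lt (a i : ℕ) (xs : List ℕ) : tableOp a i xs < a.unpair.1 + 1 :=
  Nat.mod_lt _ (Nat.succ_pos _)

theorem primrec_tableOp : Primrec fun z : ℕ × ℕ × List ℕ => tableOp z.1 z.2.1 z.2.2 := by
  have hN : Primrec fun z : ℕ × ℕ × List ℕ => z.1.unpair.1 + 1 :=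
    Primrec.succ.comp (Primrec.fst.comp (Primrec.unpair.comp Primrec.fst))
  refine Primrec.nat_mod.comp (Primrec.nat_div.comp
    (Primrec.snd.comp (Primrec.unpair.comp Primrec.fst))
    ((Primrec₂.unpaired'.1 Nat.Primrec.pow).comp hN ?_)) hN
  exact Primrec₂.natPair.comp (Primrec.fst.comp Primrec.snd)
    (Primrec.encode.comp (Primrec.snd.comp Primrec.snd))

/-- The value, in the algebra coded by `a`, of the term coded by `c` under the assignment `env`;
variables beyond the end of `env` get the value `0`. -/
def evalCode (a : ℕ) (env : List ℕ) (c : ℕ) : ℕ :=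
  if c.unpair.1 = 0 then env.getD c.unpair.2 0
  else tableOp a (c.unpair.1 - 1) ((decodeList c.unpair.2).attach.map fun x => evalCode a env x.1)
termination_by c
decreasing_by exact (lt_of_mem_decodeList x.2).trans_le (Nat.unpair_right_le c)

theorem evalCode_eq (a : ℕ) (env : List ℕ) (c : ℕ) : evalCode a env c =
    if c.unpair.1 = 0 then env.getD c.unpair.2 0
    else tableOp a (c.unpair.1 - 1) ((decodeList c.unpair.2).map (evalCode a env)) := by
  rw [evalCode]
  congr 2
  exact List.attach_map_val

theorem primrec_evalCode : Primrec fun z : (ℕ × List ℕ) × ℕ => evalCode z.1.1 z.1.2 z.2 := by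
  have hfst : Primrec fun w : ((ℕ × List ℕ) × ℕ) × List ℕ => w.1.2.unpair.1 :=
    Primrec.fst.comp (Primrec.unpair.comp (Primrec.snd.comp Primrec.fst))
  have hsnd : Primrec fun w : ((ℕ × List ℕ) × ℕ) × List ℕ => w.1.2.unpair.2 :=
    Primrec.snd.comp (Primrec.unpair.comp (Primrec.snd.comp Primrec.fst))
  refine Primrec.nat_omega_rec' (m := fun z => z.2)
    (l := fun z => (decodeList z.2.unpair.2).map fun x => (z.1, x))
    (g := fun z vs => some (if z.2.unpair.1 = 0 then z.1.2.getD z.2.unpair.2 0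
      else tableOp z.1.1 (z.2.unpair.1 - 1) vs)) _ Primrec.snd ?_ ?_ ?_ ?_
  · exact Primrec.list_map (primrec_decodeList.comp
      (Primrec.snd.comp (Primrec.unpair.comp Primrec.snd)))
      (Primrec.pair (Primrec.fst.comp Primrec.fst) Primrec.snd)
  · refine Primrec.option_some.comp (Primrec.ite
      (Primrec.eq.comp hfst (Primrec.const 0)) ?_ ?_)
    · exact (Primrec.list_getD 0).comp
        (Primrec.snd.comp (Primrec.fst.comp Primrec.fst)) hsnd
    · exact primrec_tableOp.comp (Primrec.pair (Primrec.fst.comp (Primrec.fst.comp Primrec.fst))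
        (Primrec.pair (Primrec.pred.comp hfst) Primrec.snd))
  · intro z w hw
    obtain ⟨x, hx, rfl⟩ := List.mem_map.1 hw
    exact (lt_of_mem_decodeList hx).trans_le (Nat.unpair_right_le _)
  · intro z
    rw [evalCode_eq]
    simp [Function.comp_def]

/-- The truth value, in the algebra coded by `a`, of the formula coded by `c` under the assignment
`env`. A quantifier at depth `k` binds `x_k`, so its value is appended at the end of `env`. -/
def satCode (a : ℕ) (env : List ℕ) (c : ℕ) : Bool :=
  if h1 : c.unpair.1 = 1 then
    evalCode a env c.unpair.2.unpair.1 == evalCode a env c.unpair.2.unpair.2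
  else if h2 : c.unpair.1 = 2 then
    !satCode a env c.unpair.2.unpair.1 || satCode a env c.unpair.2.unpair.2
  else if h3 : c.unpair.1 = 3 then
    ((List.range (a.unpair.1 + 1)).map fun x => satCode a (env ++ [x]) c.unpair.2).all id
  else false
termination_by c
decreasing_by
  · exact (Nat.unpair_left_le _).trans_lt (unpair_snd_lt (by omega))
  · exact (Nat.unpair_right_le _).trans_lt (unpair_snd_lt (by omega))
  · exact unpair_snd_lt (by omega)

theorem primrec_satCode : Primrec fun z : (ℕ × List ℕ) × ℕ => satCode z.1.1 z.1.2 z.2 := by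
  have h1 : Primrec fun z : (ℕ × List ℕ) × ℕ => z.2.unpair.1 :=
    Primrec.fst.comp (Primrec.unpair.comp Primrec.snd)
  have h2 : Primrec fun z : (ℕ × List ℕ) × ℕ => z.2.unpair.2 :=
    Primrec.snd.comp (Primrec.unpair.comp Primrec.snd)
  have h21 : Primrec fun z : (ℕ × List ℕ) × ℕ => z.2.unpair.2.unpair.1 :=
    Primrec.fst.comp (Primrec.unpair.comp h2)
  have h22 : Primrec fun z : (ℕ × List ℕ) × ℕ => z.2.unpair.2.unpair.2 :=
    Primrec.snd.comp (Primrec.unpair.comp h2)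
  have htag : ∀ k : ℕ, PrimrecPred fun z : (ℕ × List ℕ) × ℕ => z.2.unpair.1 = k :=
    fun k => Primrec.eq.comp h1 (Primrec.const k)
  refine Primrec.nat_omega_rec' (m := fun z => z.2)
    (l := fun z => if z.2.unpair.1 = 2 then
        [(z.1, z.2.unpair.2.unpair.1), (z.1, z.2.unpair.2.unpair.2)]
      else if z.2.unpair.1 = 3 then
        (List.range (z.1.1.unpair.1 + 1)).map fun x => ((z.1.1, z.1.2 ++ [x]), z.2.unpair.2)
      else [])
    (g := fun z vs => some (if z.2.unpair.1 = 1 then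
        evalCode z.1.1 z.1.2 z.2.unpair.2.unpair.1 == evalCode z.1.1 z.1.2 z.2.unpair.2.unpair.2
      else if z.2.unpair.1 = 2 then !(vs.getD 0 false) || vs.getD 1 false
      else if z.2.unpair.1 = 3 then vs.all id
      else false)) _ Primrec.snd ?_ ?_ ?_ ?_
  · refine Primrec.ite (htag 2) ?_ (Primrec.ite (htag 3) ?_ (Primrec.const []))
    · exact Primrec.list_cons.comp (Primrec.pair Primrec.fst h21)
        (Primrec.list_cons.comp (Primrec.pair Primrec.fst h22) (Primrec.const []))
    · refine Primrec.list_map (Primrec.list_range.comp (Primrec.succ.comp (Primrec.fst.comp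
        (Primrec.unpair.comp (Primrec.fst.comp Primrec.fst))))) ?_
      exact Primrec.pair (Primrec.pair (Primrec.fst.comp (Primrec.fst.comp Primrec.fst))
        (Primrec.list_concat.comp (Primrec.snd.comp (Primrec.fst.comp Primrec.fst)) Primrec.snd))
        (h2.comp Primrec.fst)
  · refine Primrec.option_some.comp (Primrec.ite ((htag 1).comp Primrec.fst) ?_
      (Primrec.ite ((htag 2).comp Primrec.fst) ?_ (Primrec.ite ((htag 3).comp Primrec.fst) ?_
      (Primrec.const false))))
    · exact Primrec.beq.comp
        (primrec_evalCode.comp (Primrec.pair (Primrec.fst.comp Primrec.fst) (h21.comp Primrec.fst)))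
        (primrec_evalCode.comp (Primrec.pair (Primrec.fst.comp Primrec.fst) (h22.comp Primrec.fst)))
    · exact Primrec.or.comp
        (Primrec.not.comp ((Primrec.list_getD false).comp Primrec.snd (Primrec.const 0)))
        ((Primrec.list_getD false).comp Primrec.snd (Primrec.const 1))
    · exact primrec_all.comp Primrec.snd
  · intro z w hw
    split_ifs at hw with h h'
    · simp only [List.mem_cons, List.not_mem_nil, or_false] at hw
      rcases hw with rfl | rfl
      · exact (Nat.unpair_left_le _).trans_lt (unpair_snd_lt (by omega))
      · exact (Nat.unpair_right_le _).trans_lt (unpair_snd_lt (by omega))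
    · obtain ⟨x, -, rfl⟩ := List.mem_map.1 hw
      exact unpair_snd_lt (by omega)
    · simp at hw
  · intro z
    rw [satCode]
    split_ifs <;> simp_all [Function.comp_def]

end CodedAlgebras

section Recognition

/-- Whether `c` is the code of a term in `x_0, …, x_(k-1)`; the list `sig` holds the pairs of the
code of an operation symbol and its arity. -/
def isTermCode (sig : List (ℕ × ℕ)) (k c : ℕ) : Bool :=
  if c.unpair.1 = 0 then decide (c.unpair.2 < k)
  else decide ((c.unpair.1 - 1, (decodeList c.unpair.2).length) ∈ sig) &&
    ((decodeList c.unpair.2).attach.map fun x => isTermCode sig k x.1).all id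
termination_by c
decreasing_by exact (lt_of_mem_decodeList x.2).trans_le (Nat.unpair_right_le c)

theorem isTermCode_eq (sig : List (ℕ × ℕ)) (k c : ℕ) : isTermCode sig k c =
    if c.unpair.1 = 0 then decide (c.unpair.2 < k)
    else decide ((c.unpair.1 - 1, (decodeList c.unpair.2).length) ∈ sig) &&
      ((decodeList c.unpair.2).map (isTermCode sig k)).all id := by
  rw [isTermCode, List.attach_map_val (f := isTermCode sig k)]

/-- Whether `c` is the code of a quantifier-free formula in `x_0, …, x_(k-1)`. -/
def isQFCode (sig : List (ℕ × ℕ)) (k c : ℕ) : Bool :=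
  if c = Nat.pair 0 0 then true
  else if c.unpair.1 = 1 then
    isTermCode sig k c.unpair.2.unpair.1 && isTermCode sig k c.unpair.2.unpair.2
  else if _h2 : c.unpair.1 = 2 then
    isQFCode sig k c.unpair.2.unpair.1 && isQFCode sig k c.unpair.2.unpair.2
  else false
termination_by c
decreasing_by
  · exact (Nat.unpair_left_le _).trans_lt (unpair_snd_lt (by omega))
  · exact (Nat.unpair_right_le _).trans_lt (unpair_snd_lt (by omega))

/-- Whether `c` is the code of a universal formula with free variables among `x_0, …, x_(k-1)`. -/
def isUniversalCode (sig : List (ℕ × ℕ)) (k c : ℕ) : Bool :=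
  if h3 : c.unpair.1 = 3 then isUniversalCode sig (k + 1) c.unpair.2
  else isQFCode sig k c
termination_by c
decreasing_by exact unpair_snd_lt (by omega)

theorem primrec_isTermCode (sig : List (ℕ × ℕ)) :
    Primrec fun z : ℕ × ℕ => isTermCode sig z.1 z.2 := by
  have h1 : Primrec fun w : (ℕ × ℕ) × List Bool => w.1.2.unpair.1 :=
    Primrec.fst.comp (Primrec.unpair.comp (Primrec.snd.comp Primrec.fst))
  have h2 : Primrec fun w : (ℕ × ℕ) × List Bool => w.1.2.unpair.2 :=
    Primrec.snd.comp (Primrec.unpair.comp (Primrec.snd.comp Primrec.fst))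
  refine Primrec.nat_omega_rec' (m := fun z => z.2)
    (l := fun z => (decodeList z.2.unpair.2).map fun x => (z.1, x))
    (g := fun z vs => some (if z.2.unpair.1 = 0 then decide (z.2.unpair.2 < z.1)
      else decide ((z.2.unpair.1 - 1, (decodeList z.2.unpair.2).length) ∈ sig) && vs.all id))
    _ Primrec.snd ?_ ?_ ?_ ?_
  · exact Primrec.list_map (primrec_decodeList.comp
      (Primrec.snd.comp (Primrec.unpair.comp Primrec.snd)))
      (Primrec.pair (Primrec.fst.comp Primrec.fst) Primrec.snd)
  · refine Primrec.option_some.comp (Primrec.ite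
      (Primrec.eq.comp h1 (Primrec.const 0)) ?_ ?_)
    · exact (Primrec.nat_lt.comp h2 (Primrec.fst.comp Primrec.fst)).decide
    · refine Primrec.and.comp (PrimrecPred.decide ?_) ?_
      · exact primrecRel_mem.comp (Primrec.pair (Primrec.pred.comp h1)
          (Primrec.list_length.comp (primrec_decodeList.comp h2))) (Primrec.const sig)
      · exact primrec_all.comp Primrec.snd
  · intro z w hw
    obtain ⟨x, hx, rfl⟩ := List.mem_map.1 hw
    exact (lt_of_mem_decodeList hx).trans_le (Nat.unpair_right_le _)
  · intro z
    rw [isTermCode_eq]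
    simp [Function.comp_def]

theorem primrec_isQFCode (sig : List (ℕ × ℕ)) :
    Primrec fun z : ℕ × ℕ => isQFCode sig z.1 z.2 := by
  have h1 : Primrec fun z : ℕ × ℕ => z.2.unpair.1 :=
    Primrec.fst.comp (Primrec.unpair.comp Primrec.snd)
  have h2 : Primrec fun z : ℕ × ℕ => z.2.unpair.2 :=
    Primrec.snd.comp (Primrec.unpair.comp Primrec.snd)
  have h21 : Primrec fun z : ℕ × ℕ => z.2.unpair.2.unpair.1 :=
    Primrec.fst.comp (Primrec.unpair.comp h2)
  have h22 : Primrec fun z : ℕ × ℕ => z.2.unpair.2.unpair.2 :=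
    Primrec.snd.comp (Primrec.unpair.comp h2)
  have htag : ∀ k : ℕ, PrimrecPred fun z : ℕ × ℕ => z.2.unpair.1 = k :=
    fun k => Primrec.eq.comp h1 (Primrec.const k)
  refine Primrec.nat_omega_rec' (m := fun z => z.2)
    (l := fun z => if z.2.unpair.1 = 2 then
        [(z.1, z.2.unpair.2.unpair.1), (z.1, z.2.unpair.2.unpair.2)] else [])
    (g := fun z vs => some (if z.2 = Nat.pair 0 0 then true
      else if z.2.unpair.1 = 1 then
        isTermCode sig z.1 z.2.unpair.2.unpair.1 && isTermCode sig z.1 z.2.unpair.2.unpair.2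
      else if z.2.unpair.1 = 2 then vs.getD 0 false && vs.getD 1 false
      else false)) _ Primrec.snd ?_ ?_ ?_ ?_
  · exact Primrec.ite (htag 2) (Primrec.list_cons.comp (Primrec.pair Primrec.fst h21)
        (Primrec.list_cons.comp (Primrec.pair Primrec.fst h22) (Primrec.const [])))
        (Primrec.const [])
  · refine Primrec.option_some.comp (Primrec.ite
      (Primrec.eq.comp (Primrec.snd.comp Primrec.fst) (Primrec.const _)) (Primrec.const true)
      (Primrec.ite ((htag 1).comp Primrec.fst) ?_
      (Primrec.ite ((htag 2).comp Primrec.fst) ?_ (Primrec.const false))))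
    · exact Primrec.and.comp
        ((primrec_isTermCode sig).comp
          (Primrec.pair (Primrec.fst.comp Primrec.fst) (h21.comp Primrec.fst)))
        ((primrec_isTermCode sig).comp
          (Primrec.pair (Primrec.fst.comp Primrec.fst) (h22.comp Primrec.fst)))
    · exact Primrec.and.comp
        ((Primrec.list_getD false).comp Primrec.snd (Primrec.const 0))
        ((Primrec.list_getD false).comp Primrec.snd (Primrec.const 1))
  · intro z w hw
    split_ifs at hw with h
    · simp only [List.mem_cons, List.not_mem_nil, or_false] at hw
      rcases hw with rfl | rfl
      · exact (Nat.unpair_left_le _).trans_lt (unpair_snd_lt (by omega))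
      · exact (Nat.unpair_right_le _).trans_lt (unpair_snd_lt (by omega))
    · simp at hw
  · intro z
    rw [isQFCode]
    split_ifs <;> simp_all

theorem primrec_isUniversalCode (sig : List (ℕ × ℕ)) :
    Primrec fun z : ℕ × ℕ => isUniversalCode sig z.1 z.2 := by
  have h1 : Primrec fun z : ℕ × ℕ => z.2.unpair.1 :=
    Primrec.fst.comp (Primrec.unpair.comp Primrec.snd)
  have h2 : Primrec fun z : ℕ × ℕ => z.2.unpair.2 :=
    Primrec.snd.comp (Primrec.unpair.comp Primrec.snd)
  have htag : PrimrecPred fun z : ℕ × ℕ => z.2.unpair.1 = 3 :=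
    Primrec.eq.comp h1 (Primrec.const 3)
  refine Primrec.nat_omega_rec' (m := fun z => z.2)
    (l := fun z => if z.2.unpair.1 = 3 then [(z.1 + 1, z.2.unpair.2)] else [])
    (g := fun z vs => some (if z.2.unpair.1 = 3 then vs.getD 0 false else isQFCode sig z.1 z.2))
    _ Primrec.snd ?_ ?_ ?_ ?_
  · exact Primrec.ite htag (Primrec.list_cons.comp (Primrec.pair
      (Primrec.succ.comp Primrec.fst) h2) (Primrec.const [])) (Primrec.const [])
  · exact Primrec.option_some.comp (Primrec.ite (htag.comp Primrec.fst)
      ((Primrec.list_getD false).comp Primrec.snd (Primrec.const 0))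
      ((primrec_isQFCode sig).comp Primrec.fst))
  · intro z w hw
    split_ifs at hw with h
    · simp only [List.mem_cons, List.not_mem_nil, or_false] at hw
      subst hw
      exact unpair_snd_lt (by omega)
    · simp at hw
  · intro z
    rw [isUniversalCode]
    split_ifs <;> simp_all

end Recognition

section Correctness

theorem realize_sentence_iff {L : FirstOrder.Language.{0, 0}} {M : Type} [L.Structure M]
    {φ : L.Sentence} (w : Fin 0 → M) :
    M ⊨ φ ↔ FirstOrder.Language.BoundedFormula.Realize φ Empty.elim w := by
  simp only [FirstOrder.Language.Sentence.Realize, FirstOrder.Language.Formula.Realize]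
  exact iff_of_eq (congrArg₂ _ (Subsingleton.elim _ _) (Subsingleton.elim _ _))

variable {L : FirstOrder.Language.{0, 0}} (e : (Σ n, L.Functions n) ↪ ℕ)

/-- The codes of the operation symbols, each with its arity. -/
noncomputable def signatureList [Finite (Σ n, L.Functions n)] : List (ℕ × ℕ) :=
  (Set.finite_range fun f : Σ n, L.Functions n => (e f, f.1)).toFinset.toList

theorem mem_signatureList [Finite (Σ n, L.Functions n)] {j n : ℕ} :
    (j, n) ∈ signatureList e ↔ ∃ f : L.Functions n, e ⟨n, f⟩ = j := by
  simp only [signatureList, Finset.mem_toList, Set.Finite.mem_toFinset, Set.mem_range,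
    Prod.mk.injEq]
  constructor
  · rintro ⟨⟨m, f⟩, h, rfl⟩
    exact ⟨f, h⟩
  · rintro ⟨f, h⟩
    exact ⟨⟨n, f⟩, h, rfl⟩

theorem isTermCode_iff [Finite (Σ n, L.Functions n)] {k c : ℕ} :
    isTermCode (signatureList e) k c = true ↔
      ∃ t : L.Term (Empty ⊕ Fin k), termCode e t = c := by
  induction c using Nat.strong_induction_on with
  | _ c ih =>
    rw [isTermCode_eq]
    obtain ⟨p, b, rfl⟩ : ∃ p b, c = Nat.pair p b := ⟨_, _, (Nat.pair_unpair c).symm⟩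
    simp only [Nat.unpair_pair]
    split_ifs with h
    · subst h
      rw [decide_eq_true_eq]
      constructor
      · exact fun hb => ⟨.var (Sum.inr ⟨b, hb⟩), rfl⟩
      · rintro ⟨(z | i) | ⟨f, ts⟩, ht⟩
        · exact z.elim
        · simp only [termCode, Nat.pair_eq_pair, true_and] at ht
          omega
        · simp [termCode] at ht
    · obtain ⟨j, rfl⟩ := Nat.exists_eq_succ_of_ne_zero h
      obtain ⟨l, rfl⟩ : ∃ l, b = Encodable.encode l := ⟨decodeList b, by simp⟩
      simp only [decodeList_encode, Nat.succ_eq_add_one, add_tsub_cancel_right,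
        Bool.and_eq_true, List.all_eq_true, id_eq, decide_eq_true_eq, List.mem_map,
        forall_exists_index, and_imp, forall_apply_eq_imp_iff₂]
      have ih' : ∀ x ∈ l, (isTermCode (signatureList e) k x = true ↔
          ∃ t : L.Term (Empty ⊕ Fin k), termCode e t = x) := fun x hx =>
        ih x ((lt_encode_of_mem hx).trans_le (Nat.right_le_pair _ _))
      constructor
      · rintro ⟨hj, hl⟩
        obtain ⟨f, hf⟩ := (mem_signatureList e).1 hj
        choose ts hts using fun i : Fin l.length => (ih' _ (l.get_mem i)).1 (hl _ (l.get_mem i))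
        refine ⟨.func f ts, ?_⟩
        simp only [termCode, hf, hts, List.ofFn_get]
      · rintro ⟨(z | i) | ⟨f, ts⟩, ht⟩
        · exact z.elim
        · simp [termCode] at ht
        · simp only [termCode, Nat.pair_eq_pair, add_left_inj, Encodable.encode_inj] at ht
          obtain ⟨h1, rfl⟩ := ht
          refine ⟨?_, fun x hx => (ih' x hx).2 ?_⟩
          · rw [List.length_ofFn, mem_signatureList]
            exact ⟨f, h1⟩
          · obtain ⟨i, rfl⟩ := (List.mem_ofFn' _ _).1 hx
            exact ⟨ts i, rfl⟩

variable [L.IsAlgebraic]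

theorem isQFCode_iff [Finite (Σ n, L.Functions n)] {k c : ℕ} :
    isQFCode (signatureList e) k c = true ↔
      ∃ φ : L.BoundedFormula Empty k, φ.IsQF ∧ formulaCode e φ = c := by
  constructor
  · induction c using Nat.strong_induction_on with
    | _ c ih =>
      rw [isQFCode]
      split_ifs with h0 h1 h2
      · exact fun _ => ⟨.falsum, .falsum, h0.symm⟩
      · rw [Bool.and_eq_true, isTermCode_iff, isTermCode_iff]
        rintro ⟨⟨t, ht⟩, s, hs⟩
        refine ⟨.equal t s, .of_isAtomic (.equal t s), ?_⟩
        rw [formulaCode, ht, hs, Nat.pair_unpair, ← h1, Nat.pair_unpair]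
      · have hc : c.unpair.2 < c := unpair_snd_lt (by omega)
        rw [Bool.and_eq_true]
        rintro ⟨ha, hb⟩
        obtain ⟨φ, hφ, hφ'⟩ := ih _ ((Nat.unpair_left_le _).trans_lt hc) ha
        obtain ⟨ψ, hψ, hψ'⟩ := ih _ ((Nat.unpair_right_le _).trans_lt hc) hb
        refine ⟨.imp φ ψ, .imp hφ hψ, ?_⟩
        rw [formulaCode, hφ', hψ', Nat.pair_unpair, ← h2, Nat.pair_unpair]
      · simp
  · rintro ⟨φ, hφ, rfl⟩
    induction hφ with
    | falsum => rw [isQFCode]; simp [formulaCode]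
    | of_isAtomic h =>
      cases h with
      | equal t s =>
        rw [isQFCode]
        simp [FirstOrder.Language.Term.bdEqual, formulaCode, isTermCode_iff]
      | rel r ts => exact isEmptyElim r
    | imp _ _ ih₁ ih₂ =>
      rw [isQFCode]
      simp [formulaCode, ih₁, ih₂]

theorem isUniversalCode_iff [Finite (Σ n, L.Functions n)] {k c : ℕ} :
    isUniversalCode (signatureList e) k c = true ↔
      ∃ φ : L.BoundedFormula Empty k, φ.IsUniversal ∧ formulaCode e φ = c := by
  constructor
  · induction c using Nat.strong_induction_on generalizing k with
    | _ c ih =>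
      rw [isUniversalCode]
      split_ifs with h3
      · intro h
        obtain ⟨φ, hφ, hφ'⟩ := ih _ (unpair_snd_lt (by omega)) h
        refine ⟨.all φ, .all hφ, ?_⟩
        rw [formulaCode, hφ', ← h3, Nat.pair_unpair]
      · rw [isQFCode_iff]
        exact fun ⟨φ, hφ, h⟩ => ⟨φ, .of_isQF hφ, h⟩
  · rintro ⟨φ, hφ, rfl⟩
    induction hφ with
    | of_isQF h =>
      have h' := (isQFCode_iff e).2 ⟨_, h, rfl⟩
      rw [isUniversalCode, dif_neg, h']
      intro h3
      rw [isQFCode] at h'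
      split_ifs at h' with h0 h1 h2
      · simp [h0] at h3
      · omega
      · omega
    | all _ ih =>
      rw [isUniversalCode]
      simp [formulaCode, ih]

/-- The algebra on `{0, …, N}` coded by `a = ⟨N, t⟩`. -/
def tableAlg (a : ℕ) : Alg L where
  carrier := Fin (a.unpair.1 + 1)
  str :=
    { funMap := fun {n} f xs =>
        ⟨tableOp a (e ⟨n, f⟩) (List.ofFn fun i => (xs i : ℕ)), tableOp_lt ..⟩
      RelMap := fun r _ => isEmptyElim r }

theorem evalCode_termCode (a : ℕ) {n : ℕ} (v : Fin n → (tableAlg e a).carrier)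
    (t : L.Term (Empty ⊕ Fin n)) :
    evalCode a (List.ofFn fun i => Fin.val (v i)) (termCode e t) =
      Fin.val (t.realize (Sum.elim Empty.elim v) : (tableAlg e a).carrier) := by
  induction t with
  | var x =>
    rcases x with z | i
    · exact z.elim
    · rw [evalCode_eq]
      simp [termCode]
  | func f ts ih =>
    rw [evalCode_eq]
    simp only [termCode, Nat.unpair_pair, Nat.add_eq_zero_iff, one_ne_zero, and_false, if_false,
      decodeList_encode, List.map_ofFn, Function.comp_def, ih, add_tsub_cancel_right]
    rfl

theorem satCode_formulaCode (a : ℕ) {n : ℕ} (v : Fin n → (tableAlg e a).carrier)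
    (φ : L.BoundedFormula Empty n) :
    satCode a (List.ofFn fun i => Fin.val (v i)) (formulaCode e φ) = true ↔
      φ.Realize Empty.elim v := by
  induction φ with
  | falsum => rw [satCode]; simp [formulaCode, FirstOrder.Language.BoundedFormula.Realize]
  | equal t s =>
    rw [satCode]
    simp only [formulaCode, Nat.unpair_pair, dite_true, evalCode_termCode, beq_iff_eq]
    exact Fin.val_inj
  | rel r _ => exact isEmptyElim r
  | imp φ ψ ih₁ ih₂ =>
    rw [satCode]
    simp [formulaCode, ← ih₁, ← ih₂, FirstOrder.Language.BoundedFormula.realize_imp,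
      imp_iff_not_or]
  | all φ ih =>
    rw [satCode]
    simp only [formulaCode, Nat.unpair_pair, FirstOrder.Language.BoundedFormula.realize_all, ← ih]
    simp only [OfNat.ofNat_ne_one, (by decide : ¬ (3 : ℕ) = 2), dite_false, dite_true,
      List.all_map, List.all_eq_true,
      List.mem_range, Function.comp_def, id_eq]
    have key : ∀ x : (tableAlg e a).carrier, (List.ofFn fun i => Fin.val 
        (Fin.snoc (α := fun _ => (tableAlg e a).carrier) v x i)) =
          (List.ofFn fun i => Fin.val (v i)) ++ [Fin.val x] := by
      intro x
      rw [List.ofFn_succ_last]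
      simp
    simp only [key]
    exact ⟨fun h x => h _ x.2, fun h x hx => h ⟨x, hx⟩⟩

theorem satCode_sentence (a : ℕ) (φ : L.Sentence) :
    satCode a [] (formulaCode e φ) = true ↔ (tableAlg e a).carrier ⊨ φ := by
  have := satCode_formulaCode e a (Fin.elim0 : Fin 0 → (tableAlg e a).carrier) φ
  rw [List.ofFn_zero] at this
  exact this.trans (realize_sentence_iff _).symm

end Correctness

/-! ### Equational logic -/

section FiniteBasis

variable {L : FirstOrder.Language.{0, 0}}

/-- Only finitely many variables matter for the value of a term. -/
theorem exists_realize_congr_bound (t : L.Term ℕ) :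
    ∃ n, ∀ (M : Type) [L.Structure M] (v v' : ℕ → M), (∀ i < n, v i = v' i) →
      t.realize v = t.realize v' := by
  induction t with
  | var i => exact ⟨i + 1, fun M _ v v' h => h i (Nat.lt_succ_self i)⟩
  | func f ts ih =>
    choose b hb using ih
    refine ⟨Finset.univ.sup b, fun M _ v v' h => ?_⟩
    refine congrArg (FirstOrder.Language.Structure.funMap f) (funext fun i => ?_)
    exact hb i M v v' fun j hj => h j (hj.trans_le (Finset.le_sup (Finset.mem_univ i)))

/-- An equation is expressed by a first-order sentence. -/
theorem exists_sentence_of_equation (p : L.Term ℕ × L.Term ℕ) :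
    ∃ φ : L.Sentence, ∀ A : Alg L, A.carrier ⊨ φ ↔ A.SatEq p.1 p.2 := by
  obtain ⟨n₁, h₁⟩ := exists_realize_congr_bound p.1
  obtain ⟨n₂, h₂⟩ := exists_realize_congr_bound p.2
  let N := n₁ + n₂
  let g : ℕ → Empty ⊕ Fin (N + 1) := fun i => Sum.inr (Fin.ofNat (N + 1) i)
  refine ⟨FirstOrder.Language.Formula.iAlls (Fin (N + 1))
    ((p.1.relabel g).equal (p.2.relabel g)), fun A => ?_⟩
  have key : ∀ (v : ℕ → A.carrier) (i : ℕ), i < N + 1 → v (Fin.ofNat (N + 1) i) = v i :=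
    fun v i hi => congrArg v (Nat.mod_eq_of_lt hi)
  rw [FirstOrder.Language.Sentence.Realize, FirstOrder.Language.Formula.realize_iAlls]
  simp only [FirstOrder.Language.Formula.realize_equal, FirstOrder.Language.Term.realize_relabel]
  constructor
  · intro h v
    exact (h₁ _ _ _ fun i hi => (key v i (by omega)).symm).trans
      ((h fun i => v i).trans (h₂ _ _ _ fun i hi => key v i (by omega)))
  · exact fun h v => h _

/-- By compactness, a finitely axiomatizable variety has a finite equational basis. -/
theorem exists_finite_basis {V : Set (Alg L)} (hV : IsVariety V) (hfin : FinitelyAxiomatizable V) :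
    ∃ E : List (L.Term ℕ × L.Term ℕ), ∀ A : Alg L, A ∈ V ↔ ∀ p ∈ E, A.SatEq p.1 p.2 := by
  classical
  obtain ⟨E, rfl⟩ := hV
  obtain ⟨T, hT, hTE⟩ := hfin
  choose S hS using exists_sentence_of_equation (L := L)
  have hsub : ∀ ψ ∈ T, ∃ E₀ : Finset (L.Term ℕ × L.Term ℕ), ↑E₀ ⊆ E ∧
      ∀ A : Alg L, (∀ p ∈ E₀, A.SatEq p.1 p.2) → A.carrier ⊨ ψ := by
    intro ψ hψ
    have hmod : FirstOrder.Language.Theory.ModelsBoundedFormula (S '' E) ψ := by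
      rw [FirstOrder.Language.Theory.models_sentence_iff]
      intro M
      let A : Alg L := ⟨M⟩
      have hA : A ∈ modelClass T := by
        rw [hTE]
        intro p hp
        exact (hS p A).1 (FirstOrder.Language.Theory.realize_sentence_of_mem (S '' E)
          (Set.mem_image_of_mem S hp))
      exact hA ψ hψ
    obtain ⟨T₀, hT₀, hT₀ψ⟩ := FirstOrder.Language.Theory.models_iff_finset_models.1 hmod
    obtain ⟨E₀, hE₀, rfl⟩ := Finset.subset_set_image_iff.1 hT₀
    refine ⟨E₀, hE₀, fun A hA => ?_⟩
    have : A.carrier ⊨ ((E₀.image S : Finset L.Sentence) : L.Theory) := by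
      refine ⟨fun φ hφ => ?_⟩
      obtain ⟨p, hp, rfl⟩ := Finset.mem_image.1 (Finset.mem_coe.1 hφ)
      exact (hS p A).2 (hA p hp)
    exact hT₀ψ.realize_sentence A.carrier
  choose! E₀ hE₀ hE₀T using hsub
  refine ⟨(hT.toFinset.biUnion E₀).toList, fun A => ⟨fun hA p hp => ?_, fun hA => ?_⟩⟩
  · obtain ⟨ψ, hψ, hp⟩ := Finset.mem_biUnion.1 (Finset.mem_toList.1 hp)
    exact hA p (hE₀ ψ (hT.mem_toFinset.1 hψ) hp)
  · rw [← hTE]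
    exact fun ψ hψ => hE₀T ψ hψ A fun p hp => hA p <| Finset.mem_toList.2 <|
      Finset.mem_biUnion.2 ⟨ψ, hT.mem_toFinset.2 hψ, hp⟩

end FiniteBasis

section Derivations

variable {L : FirstOrder.Language.{0, 0}} [L.IsAlgebraic] (e : (Σ n, L.Functions n) ↪ ℕ)

/-- The algebra of term codes: the natural numbers, where each operation forms the code of the
compound term. Numbers that are not values of operations act as free generators. -/
def codeAlg : Alg L where
  carrier := ℕ
  str :=
    { funMap := fun {n} f xs => Nat.pair (e ⟨n, f⟩ + 1) (Encodable.encode (List.ofFn xs))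
      RelMap := fun r _ => isEmptyElim r }

/-- The code of the term `t`, where the variable `i` is replaced by the number `v i`. -/
def substCode (v : ℕ → ℕ) (t : L.Term ℕ) : ℕ :=
  t.realize (M := (codeAlg e).carrier) v

theorem hom_substCode {A : Alg L} (h : (codeAlg e).carrier →[L] A.carrier) (v : ℕ → ℕ)
    (t : L.Term ℕ) : h (substCode e v t) = t.realize fun i => h (v i) :=
  (FirstOrder.Language.HomClass.realize_term h).symm

/-- The code of a term in the variables `x_0, x_1, …`. -/
def varTermCode (t : L.Term ℕ) : ℕ := substCode e (Nat.pair 0) t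

theorem termCode_eq_varTermCode {k : ℕ} (t : L.Term (Empty ⊕ Fin k)) :
    termCode e t = varTermCode e (t.relabel (Sum.elim Empty.elim Fin.val)) := by
  induction t with
  | var x =>
    rcases x with z | i
    · exact z.elim
    · rfl
  | func f ts ih =>
    simp only [termCode, ih]
    rfl

theorem primrec_substCode (t : L.Term ℕ) :
    Primrec fun env : List ℕ => substCode e (fun i => env.getD i 0) t := by
  induction t with
  | var i => exact (Primrec.list_getD 0).comp Primrec.id (Primrec.const i)
  | func f ts ih =>
    exact Primrec₂.natPair.comp (Primrec.const _)
      (Primrec.encode.comp (Primrec.list_ofFn ih))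

/-- The rules of equational logic with the axioms `E`, acting on codes of terms. The number `w`
codes the substitution into an axiom, the middle term of transitivity, or the operation symbol of a
congruence step. -/
def eqRule [Finite (Σ n, L.Functions n)] (E : List (L.Term ℕ × L.Term ℕ)) (w : ℕ)
    (l : List (ℕ × ℕ)) (y : ℕ × ℕ) : Prop :=
  (∃ p ∈ E, y = (substCode e (fun i => (decodeList w).getD i 0) p.1,
    substCode e (fun i => (decodeList w).getD i 0) p.2)) ∨
  y.1 = y.2 ∨ l = [(y.2, y.1)] ∨ l = [(y.1, w), (w, y.2)] ∨
  ((w, l.length) ∈ signatureList e ∧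
    y = (Nat.pair (w + 1) (Encodable.encode (l.map Prod.fst)),
      Nat.pair (w + 1) (Encodable.encode (l.map Prod.snd))))

theorem primrecPred_eqRule [Finite (Σ n, L.Functions n)] (E : List (L.Term ℕ × L.Term ℕ)) :
    PrimrecPred fun s : ℕ × List (ℕ × ℕ) × ℕ × ℕ => eqRule e E s.1 s.2.1 s.2.2 := by
  have hw : Primrec fun s : ℕ × List (ℕ × ℕ) × ℕ × ℕ => s.1 := Primrec.fst
  have hl : Primrec fun s : ℕ × List (ℕ × ℕ) × ℕ × ℕ => s.2.1 := Primrec.fst.comp Primrec.snd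
  have hy : Primrec fun s : ℕ × List (ℕ × ℕ) × ℕ × ℕ => s.2.2 := Primrec.snd.comp Primrec.snd
  have hy1 := Primrec.fst.comp hy
  have hy2 := Primrec.snd.comp hy
  refine PrimrecPred.or ?_ (PrimrecPred.or (Primrec.eq.comp hy1 hy2) (PrimrecPred.or
    (Primrec.eq.comp hl ?_) (PrimrecPred.or (Primrec.eq.comp hl ?_) (PrimrecPred.and ?_
      (Primrec.eq.comp hy (Primrec.pair ?_ ?_))))))
  · induction E with
    | nil =>
      exact PrimrecPred.of_eq (Primrec.eq.comp (Primrec.const 0) (Primrec.const 1))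
        fun s => by simp
    | cons p E ih =>
      have h1 : ∀ t : L.Term ℕ, Primrec fun s : ℕ × List (ℕ × ℕ) × ℕ × ℕ =>
          substCode e (fun i => (decodeList s.1).getD i 0) t := fun t =>
        (primrec_substCode e t).comp (primrec_decodeList.comp hw)
      exact ((Primrec.eq.comp hy (Primrec.pair (h1 p.1) (h1 p.2))).or ih).of_eq fun s => by simp
  · exact Primrec.list_cons.comp (Primrec.pair hy2 hy1) (Primrec.const [])
  · exact Primrec.list_cons.comp (Primrec.pair hy1 hw)
      (Primrec.list_cons.comp (Primrec.pair hw hy2) (Primrec.const []))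
  · exact primrecRel_mem.comp (Primrec.pair hw (Primrec.list_length.comp hl)) (Primrec.const _)
  · exact Primrec₂.natPair.comp (Primrec.succ.comp hw)
      (Primrec.encode.comp (Primrec.list_map hl (Primrec.fst.comp Primrec.snd)))
  · exact Primrec₂.natPair.comp (Primrec.succ.comp hw)
      (Primrec.encode.comp (Primrec.list_map hl (Primrec.snd.comp Primrec.snd)))

open Classical in
/-- The homomorphism from the algebra of term codes to `A` that takes the variable `x_i` to `v i`.
The value at a free generator `c` that codes no variable is irrelevant. -/
noncomputable def evalHomFun (A : Alg L) (v : ℕ → A.carrier) (c : ℕ) : A.carrier :=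
  if h : ∃ f : Σ n, L.Functions n, ∃ xs : Fin f.1 → ℕ,
      c = Nat.pair (e f + 1) (Encodable.encode (List.ofFn xs)) then
    FirstOrder.Language.Structure.funMap h.choose.2
      fun i => evalHomFun A v (h.choose_spec.choose i)
  else v c.unpair.2
termination_by c
decreasing_by
  conv_rhs => rw [h.choose_spec.choose_spec]
  exact (lt_encode_of_mem ((List.mem_ofFn' _ _).2 ⟨i, rfl⟩)).trans_le (Nat.right_le_pair _ _)

theorem exists_hom_codeAlg (A : Alg L) (v : ℕ → A.carrier) :
    ∃ h : (codeAlg e).carrier →[L] A.carrier, ∀ i : ℕ, h (Nat.pair 0 i : ℕ) = v i := by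
  refine ⟨⟨evalHomFun e A v, ?_, fun r => isEmptyElim r⟩, fun i => ?_⟩
  · intro n f (xs : Fin n → ℕ)
    change evalHomFun e A v (Nat.pair (e ⟨n, f⟩ + 1) (Encodable.encode (List.ofFn xs))) = _
    have h : ∃ f' : Σ n, L.Functions n, ∃ xs' : Fin f'.1 → ℕ,
        Nat.pair (e ⟨n, f⟩ + 1) (Encodable.encode (List.ofFn xs)) =
          Nat.pair (e f' + 1) (Encodable.encode (List.ofFn xs')) := ⟨⟨n, f⟩, xs, rfl⟩
    rw [evalHomFun, dif_pos h]
    have h3 := h.choose_spec.choose_spec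
    generalize h.choose_spec.choose = xs' at h3
    generalize h.choose = f' at xs' h3
    obtain ⟨n', f'⟩ := f'
    simp only [Nat.pair_eq_pair, add_left_inj, EmbeddingLike.apply_eq_iff_eq,
      Encodable.encode_inj] at h3
    obtain ⟨h3, h4⟩ := h3
    cases h3
    rw [List.ofFn_injective h4]
    rfl
  · change evalHomFun e A v (Nat.pair 0 i) = v i
    rw [evalHomFun, dif_neg]
    · simp
    · rintro ⟨f, xs, h⟩
      simp at h

section EqDerivable

variable [Finite (Σ n, L.Functions n)] (E : List (L.Term ℕ × L.Term ℕ))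

/-- The equation between the terms coded by `c` and `d` is derivable from the axioms `E`. -/
def EqDerivable (c d : ℕ) : Prop := Derivable (eqRule e E) (c, d)

theorem isSigmaOne_eqDerivable : IsSigmaOne fun z : ℕ × ℕ => EqDerivable e E z.1 z.2 :=
  IsSigmaOne.derivable (primrecPred_eqRule e E)

variable {e E}

theorem EqDerivable.refl (c : ℕ) : EqDerivable e E c c :=
  .intro 0 [] _ (Or.inr (Or.inl rfl)) (by simp)

theorem EqDerivable.symm {c d : ℕ} (h : EqDerivable e E c d) : EqDerivable e E d c :=
  .intro 0 [(c, d)] _ (Or.inr (Or.inr (Or.inl rfl)))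
    (List.forall_mem_singleton.2 h)

theorem EqDerivable.trans {c d b : ℕ} (h : EqDerivable e E c d) (h' : EqDerivable e E d b) :
    EqDerivable e E c b :=
  .intro d [(c, d), (d, b)] _ (Or.inr (Or.inr (Or.inr (Or.inl rfl))))
    (List.forall_mem_cons.2 ⟨h, List.forall_mem_singleton.2 h'⟩)

theorem EqDerivable.congr {n : ℕ} (f : L.Functions n) {xs ys : Fin n → ℕ}
    (h : ∀ i, EqDerivable e E (xs i) (ys i)) :
    EqDerivable e E (Nat.pair (e ⟨n, f⟩ + 1) (Encodable.encode (List.ofFn xs)))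
      (Nat.pair (e ⟨n, f⟩ + 1) (Encodable.encode (List.ofFn ys))) := by
  refine .intro (e ⟨n, f⟩) (List.ofFn fun i => (xs i, ys i)) _
    (Or.inr (Or.inr (Or.inr (Or.inr ⟨?_, ?_⟩)))) fun z hz => ?_
  · rw [List.length_ofFn, mem_signatureList]
    exact ⟨f, rfl⟩
  · simp [List.map_ofFn, Function.comp_def]
  · obtain ⟨i, rfl⟩ := (List.mem_ofFn' _ _).1 hz
    exact h i

theorem EqDerivable.axm {p : L.Term ℕ × L.Term ℕ} (hp : p ∈ E) (v : ℕ → ℕ) :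
    EqDerivable e E (substCode e v p.1) (substCode e v p.2) := by
  obtain ⟨n₁, h₁⟩ := exists_realize_congr_bound p.1
  obtain ⟨n₂, h₂⟩ := exists_realize_congr_bound p.2
  -- A substitution matters only on finitely many variables, hence is coded by a list.
  let env : List ℕ := List.ofFn fun i : Fin (n₁ + n₂) => v i
  have henv : ∀ i < n₁ + n₂, v i = env.getD i 0 := by
    intro i hi
    simp [env, hi]
  refine .intro (Encodable.encode env) [] _ (Or.inl ⟨p, hp, ?_⟩) (by simp)
  simp only [decodeList_encode, Prod.mk.injEq]
  exact ⟨h₁ (codeAlg e).carrier _ _ fun i hi => henv i (by omega),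
    h₂ (codeAlg e).carrier _ _ fun i hi => henv i (by omega)⟩

/-- Soundness of equational logic: derivably equal numbers agree in every model of the axioms. -/
theorem EqDerivable.hom_eq {A : Alg L} (hA : ∀ p ∈ E, A.SatEq p.1 p.2)
    (h : (codeAlg e).carrier →[L] A.carrier) {c d : ℕ} (hcd : EqDerivable e E c d) :
    h c = h d := by
  suffices ∀ y : ℕ × ℕ, Derivable (eqRule e E) y → h y.1 = h y.2 from this _ hcd
  intro y hy
  induction hy with
  | intro w l y hr _ ih =>
    rcases hr with ⟨p, hp, rfl⟩ | hr | rfl | rfl | ⟨hw, rfl⟩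
    · exact (hom_substCode e h _ _).trans ((hA p hp _).trans (hom_substCode e h _ _).symm)
    · rw [hr]
    · exact (ih (y.2, y.1) (by simp)).symm
    · exact (ih (y.1, w) (by simp)).trans (ih (w, y.2) (by simp))
    · obtain ⟨f, rfl⟩ := (mem_signatureList e).1 hw
      have key : ∀ g : ℕ × ℕ → ℕ, h (Nat.pair (e ⟨l.length, f⟩ + 1)
          (Encodable.encode (l.map g)) : ℕ) =
          FirstOrder.Language.Structure.funMap f fun i => h (g (l.get i) : ℕ) := by
        intro g
        have h1 : l.map g = List.ofFn fun i => g (l.get i) := by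
          conv_lhs => rw [← List.ofFn_get l, List.map_ofFn]
          rfl
        rw [h1]
        exact h.map_fun f fun i => g (l.get i)
      rw [key, key]
      exact congrArg _ (funext fun i => ih _ (l.get_mem i))

variable (e E)

/-- Derivable equality as an equivalence relation on the algebra of term codes. -/
def codeSetoid : Setoid (codeAlg e).carrier where
  r := EqDerivable e E
  iseqv := ⟨.refl, .symm, .trans⟩

/-- Derivable equality is a congruence of the algebra of term codes. -/
instance codePrestructure : L.Prestructure (codeSetoid e E) where
  toStructure := (codeAlg e).str
  fun_equiv := fun {_} f _ _ h => EqDerivable.congr f h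
  rel_equiv := fun {_} r => isEmptyElim r

/-- The algebra of term codes modulo derivable equality. -/
def codeQuotient : Alg L where
  carrier := Quotient (codeSetoid e E)
  nonempty := ⟨Quotient.mk _ (0 : ℕ)⟩
  str := inferInstance

theorem realize_codeQuotient (t : L.Term ℕ) (v : ℕ → ℕ) :
    t.realize (M := (codeQuotient e E).carrier) (fun i => Quotient.mk _ (v i)) =
      Quotient.mk (codeSetoid e E) (substCode e v t) :=
  FirstOrder.Language.Term.realize_quotient_mk' (s := codeSetoid e E) t v

theorem satEq_codeQuotient {p : L.Term ℕ × L.Term ℕ} (hp : p ∈ E) :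
    (codeQuotient e E).SatEq p.1 p.2 := by
  intro v
  have hv : v = fun i => Quotient.mk (codeSetoid e E) (v i).out := by
    funext i
    exact (Quotient.out_eq (v i)).symm
  rw [hv]
  exact (realize_codeQuotient e E _ _).trans ((Quotient.sound (EqDerivable.axm hp _)).trans
    (realize_codeQuotient e E _ _).symm)

/-- Completeness of equational logic, for codes of terms. -/
theorem eqDerivable_varTermCode_iff {V : Set (Alg L)}
    (hE : ∀ A : Alg L, A ∈ V ↔ ∀ p ∈ E, A.SatEq p.1 p.2) (t s : L.Term ℕ) :
    EqDerivable e E (varTermCode e t) (varTermCode e s) ↔ ∀ A ∈ V, A.SatEq t s := by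
  constructor
  · intro hts A hA v
    obtain ⟨h, hv⟩ := exists_hom_codeAlg e A v
    obtain rfl : (fun i => h (Nat.pair 0 i : ℕ)) = v := funext hv
    exact (hom_substCode e h _ t).symm.trans
      ((EqDerivable.hom_eq ((hE A).1 hA) h hts).trans (hom_substCode e h _ s))
  · intro h
    have hQ : codeQuotient e E ∈ V := (hE _).2 fun p hp => satEq_codeQuotient e E hp
    have := h _ hQ fun i => Quotient.mk _ (Nat.pair 0 i)
    exact Quotient.exact ((realize_codeQuotient e E t _).symm.trans
      (this.trans (realize_codeQuotient e E s _)))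

end EqDerivable

end Derivations

/-! ### Coding of finite algebras, and the free algebra -/

section CodingFiniteAlgebras

/-- Every finite sequence of digits in base `N + 1` comes from a number. -/
theorem exists_digits (N : ℕ) (g : ℕ → ℕ) (hg : ∀ i, g i < N + 1) (K : ℕ) :
    ∃ t < (N + 1) ^ K, ∀ i < K, t / (N + 1) ^ i % (N + 1) = g i := by
  induction K generalizing g with
  | zero => exact ⟨0, by simp, by simp⟩
  | succ K ih =>
    obtain ⟨t, ht, h⟩ := ih (fun i => g (i + 1)) fun i => hg _
    refine ⟨g 0 + (N + 1) * t, ?_, fun i hi => ?_⟩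
    · have := hg 0
      rw [pow_succ]
      nlinarith
    · cases i with
      | zero => simp [Nat.mod_eq_of_lt (hg 0)]
      | succ i =>
        rw [pow_succ', ← Nat.div_div_eq_div_mul, Nat.add_mul_div_left _ _ (Nat.succ_pos N),
          Nat.div_eq_of_lt (hg 0), zero_add]
        exact h i (by omega)

theorem pair_le_pair {a b c d : ℕ} (hac : a ≤ c) (hbd : b ≤ d) : Nat.pair a b ≤ Nat.pair c d := by
  have h1 : Nat.pair a b ≤ Nat.pair c b := by
    rcases hac.eq_or_lt with rfl | h
    · exact le_rfl
    · exact (Nat.pair_lt_pair_left b h).le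
  have h2 : Nat.pair c b ≤ Nat.pair c d := by
    rcases hbd.eq_or_lt with rfl | h
    · exact le_rfl
    · exact (Nat.pair_lt_pair_right c h).le
  exact h1.trans h2

theorem exists_encode_bound (M : ℕ) : ∃ b : ℕ → ℕ, Primrec b ∧ ∀ (N : ℕ) (l : List ℕ),
    l.length = M → (∀ x ∈ l, x < N + 1) → Encodable.encode l ≤ b N := by
  induction M with
  | zero =>
    exact ⟨fun _ => 0, Primrec.const 0, fun N l hl _ => by simp [List.length_eq_zero_iff.1 hl]⟩
  | succ M ih =>
    obtain ⟨b, hb, h⟩ := ih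
    refine ⟨fun N => (Nat.pair N (b N)).succ,
      Primrec.succ.comp (Primrec₂.natPair.comp Primrec.id hb), fun N l hl hx => ?_⟩
    match l, hl, hx with
    | x :: l, hl, hx =>
      rw [Encodable.encode_list_cons]
      exact Nat.succ_le_succ (pair_le_pair (Nat.lt_succ_iff.1 (hx x (by simp)))
        (h N l (by simpa using hl) fun y hy => hx y (by simp [hy])))

/-- The positions in operation tables on `{0, …, N}` have a primitive recursive bound. -/
theorem exists_position_bound (sig : List (ℕ × ℕ)) : ∃ B : ℕ → ℕ, Primrec B ∧
    ∀ (N : ℕ), ∀ s ∈ sig, ∀ l : List ℕ, l.length = s.2 → (∀ x ∈ l, x < N + 1) →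
      Nat.pair s.1 (Encodable.encode l) < B N := by
  induction sig with
  | nil => exact ⟨fun _ => 0, Primrec.const 0, by simp⟩
  | cons s sig ih =>
    obtain ⟨B, hB, h⟩ := ih
    obtain ⟨b, hb, hb'⟩ := exists_encode_bound s.2
    refine ⟨fun N => (Nat.pair s.1 (b N)).succ + B N, Primrec.nat_add.comp
      (Primrec.succ.comp (Primrec₂.natPair.comp (Primrec.const _) hb)) hB,
      fun N s' hs' l hl hx => ?_⟩
    rcases List.mem_cons.1 hs' with rfl | hs'
    · exact (Nat.lt_succ_of_le (pair_le_pair le_rfl (hb' N l hl hx))).trans_le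
        (Nat.le_add_right _ _)
    · exact (h N s' hs' l hl hx).trans_le (Nat.le_add_left _ _)

variable {L : FirstOrder.Language.{0, 0}} [L.IsAlgebraic] (e : (Σ n, L.Functions n) ↪ ℕ)

/-- Every finite algebra is isomorphic to a coded one, and the table can be bounded in terms of its
size: only the digits at positions that belong to an operation symbol matter. -/
theorem exists_equiv_tableAlg [Finite (Σ n, L.Functions n)] {B : ℕ → ℕ}
    (hB : ∀ (N : ℕ), ∀ s ∈ signatureList e, ∀ l : List ℕ, l.length = s.2 →
      (∀ x ∈ l, x < N + 1) → Nat.pair s.1 (Encodable.encode l) < B N)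
    (A : Alg L) {N : ℕ} (ψ : A.carrier ≃ Fin (N + 1)) :
    ∃ t < (N + 1) ^ B N, Nonempty (A.carrier ≃[L] (tableAlg e (Nat.pair N t)).carrier) := by
  classical
  let pos : (Σ f : Σ n, L.Functions n, Fin f.1 → A.carrier) → ℕ := fun q =>
    Nat.pair (e q.1) (Encodable.encode (List.ofFn fun i => (ψ (q.2 i)).val))
  have hpos : Function.Injective pos := by
    rintro ⟨f, xs⟩ ⟨g, ys⟩ h
    simp only [pos, Nat.pair_eq_pair, EmbeddingLike.apply_eq_iff_eq, Encodable.encode_inj] at h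
    obtain ⟨rfl, h⟩ := h
    congr
    funext i
    exact ψ.injective (Fin.ext (congrFun (List.ofFn_injective h) i))
  let val : (Σ f : Σ n, L.Functions n, Fin f.1 → A.carrier) → Fin (N + 1) := fun q =>
    ψ (FirstOrder.Language.Structure.funMap q.1.2 q.2)
  obtain ⟨t, ht, h⟩ := exists_digits N
    (fun c => (Function.extend pos val (fun _ => 0) c).val) (fun c => Fin.is_lt _) (B N)
  refine ⟨t, ht, ⟨⟨ψ.trans (finCongr (by simp)), fun {n} f xs => ?_,
    fun r => isEmptyElim r⟩⟩⟩
  refine Fin.ext ?_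
  change (ψ (FirstOrder.Language.Structure.funMap f xs)).val =
    tableOp (Nat.pair N t) (e ⟨n, f⟩) (List.ofFn fun i => (ψ (xs i)).val)
  have hlt : pos ⟨⟨n, f⟩, xs⟩ < B N := by
    refine hB N (e ⟨n, f⟩, n) ((mem_signatureList e).2 ⟨f, rfl⟩) _ (List.length_ofFn) ?_
    intro x hx
    obtain ⟨i, rfl⟩ := (List.mem_ofFn' _ _).1 hx
    exact Fin.is_lt _
  have := h _ hlt
  rw [hpos.extend_apply] at this
  simp only [tableOp, Nat.unpair_pair]
  exact this.symm

end CodingFiniteAlgebras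

section FreeAlgebra

variable {L : FirstOrder.Language.{0, 0}}

theorem exists_term_of_mem_closure_range {M : Type} [L.Structure M] {k : ℕ} {w : Fin k → M} {y : M}
    (hy : y ∈ FirstOrder.Language.Substructure.closure L (Set.range w)) :
    ∃ t : L.Term (Empty ⊕ Fin k), t.realize (Sum.elim Empty.elim w) = y := by
  obtain ⟨t, rfl⟩ := FirstOrder.Language.Substructure.mem_closure_iff_exists_term.1 hy
  choose g hg using fun x : Set.range w => x.2
  refine ⟨t.relabel fun x => Sum.inr (g x), ?_⟩
  rw [FirstOrder.Language.Term.realize_relabel]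
  exact congrArg (fun v => t.realize v) (funext hg)

theorem satEq_of_injective {A B : Alg L} (h : A.carrier →[L] B.carrier)
    (hh : Function.Injective h) {t s : L.Term ℕ} (hB : B.SatEq t s) : A.SatEq t s := by
  intro v
  apply hh
  rw [← FirstOrder.Language.HomClass.realize_term, ← FirstOrder.Language.HomClass.realize_term]
  exact hB _

/-- The failure of a universal formula is witnessed by finitely many elements; their number is
bounded by the code of the formula. -/
theorem exists_witnesses [L.IsAlgebraic] (e : (Σ n, L.Functions n) ↪ ℕ) {A : Type} [L.Structure A]
    {k : ℕ} {φ : L.BoundedFormula Empty k} (hφ : φ.IsUniversal) (w : Fin k → A)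
    (hw : ¬ φ.Realize Empty.elim w) :
    ∃ W : List A, W.length ≤ formulaCode e φ ∧ ∀ B : L.Substructure A, (∀ x ∈ W, x ∈ B) →
      ∀ w' : Fin k → B, (∀ i, (w' i : A) = w i) → ¬ φ.Realize Empty.elim w' := by
  induction hφ with
  | of_isQF h =>
    refine ⟨[], by simp, fun B _ w' hw' h' => hw ?_⟩
    have := (h.realize_embedding B.subtype (v := Empty.elim) (xs := w')).2 h'
    rw [← (funext hw' : (fun i => (w' i : A)) = w)]
    convert this using 1
    rfl
  | all _ ih =>
    rw [FirstOrder.Language.BoundedFormula.realize_all] at hw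
    push Not at hw
    obtain ⟨x, hx⟩ := hw
    obtain ⟨W, hW, h⟩ := ih _ hx
    refine ⟨x :: W, ?_, fun B hB w' hw' h' => ?_⟩
    · have := Nat.add_le_pair 3 (formulaCode e ‹L.BoundedFormula Empty _›)
      simp only [List.length_cons, formulaCode]
      omega
    · rw [FirstOrder.Language.BoundedFormula.realize_all] at h'
      refine h B (fun y hy => hB y (by simp [hy])) (Fin.snoc w' ⟨x, hB x (by simp)⟩)
        (fun i => ?_) (h' _)
      refine Fin.lastCases ?_ (fun j => ?_) i
      · simp
      · simp [hw']

variable [L.IsAlgebraic] (V : Set (Alg L))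

/-- The free generators of the free algebra. -/
def freeGen (i : ℕ) : (freeAlg V ℕ).carrier :=
  Quotient.mk (freeSetoid V ℕ) (FirstOrder.Language.Term.var i)

theorem mk_func {n : ℕ} (f : L.Functions n) (ts : Fin n → L.Term ℕ) :
    (Quotient.mk (freeSetoid V ℕ) (FirstOrder.Language.Term.func f ts) : (freeAlg V ℕ).carrier) =
      FirstOrder.Language.Structure.funMap (M := (freeAlg V ℕ).carrier) f
        fun i => Quotient.mk (freeSetoid V ℕ) (ts i) :=
  (FirstOrder.Language.funMap_quotient_mk' (s := freeSetoid V ℕ) f ts).symm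

theorem realize_freeGen (t : L.Term ℕ) :
    t.realize (freeGen V) = (Quotient.mk (freeSetoid V ℕ) t : (freeAlg V ℕ).carrier) := by
  induction t with
  | var i => rfl
  | func f ts ih =>
    rw [mk_func, FirstOrder.Language.Term.realize_func]
    exact congrArg _ (funext ih)

theorem realize_freeAlg (t : L.Term ℕ) (τ : ℕ → L.Term ℕ) :
    t.realize (M := (freeAlg V ℕ).carrier) (fun i => Quotient.mk (freeSetoid V ℕ) (τ i)) =
      Quotient.mk (freeSetoid V ℕ) (t.subst τ) := by
  induction t with
  | var i => rfl
  | func f ts ih =>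
    refine Eq.trans ?_ (mk_func V f _).symm
    exact congrArg _ (funext ih)

variable {V}

theorem freeAlg_mem {E : List (L.Term ℕ × L.Term ℕ)}
    (hE : ∀ A : Alg L, A ∈ V ↔ ∀ p ∈ E, A.SatEq p.1 p.2) : freeAlg V ℕ ∈ V := by
  refine (hE _).2 fun p hp v => ?_
  have hv : v = fun i => Quotient.mk (freeSetoid V ℕ) (v i).out := by
    funext i
    exact (Quotient.out_eq (v i)).symm
  rw [hv]
  refine (realize_freeAlg V _ _).trans ((Quotient.sound fun A hA u => ?_).trans
    (realize_freeAlg V _ _).symm)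
  rw [FirstOrder.Language.Term.realize_subst, FirstOrder.Language.Term.realize_subst]
  exact (hE A).1 hA p hp _

/-- The subalgebra of the free algebra generated by the free generators `x_0, …, x_n`. -/
def finiteRankFree (V : Set (Alg L)) (n : ℕ) : L.Substructure (freeAlg V ℕ).carrier :=
  FirstOrder.Language.Substructure.closure L (Set.range fun i : Fin (n + 1) => freeGen V i)

theorem exists_mem_finiteRankFree (y : (freeAlg V ℕ).carrier) :
    ∃ n, ∀ m ≥ n, y ∈ finiteRankFree V m := by
  induction y using Quotient.inductionOn with
  | _ t =>
    induction t with
    | var i =>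
      exact ⟨i, fun m hm => FirstOrder.Language.Substructure.subset_closure
        ⟨⟨i, by omega⟩, rfl⟩⟩
    | func f ts ih =>
      choose b hb using ih
      refine ⟨Finset.univ.sup b, fun m hm => ?_⟩
      rw [mk_func]
      exact (finiteRankFree V m).fun_mem f _ fun i =>
        hb i m ((Finset.le_sup (Finset.mem_univ i)).trans hm)

theorem exists_forall_mem_finiteRankFree (W : List (freeAlg V ℕ).carrier) :
    ∃ n, ∀ y ∈ W, y ∈ finiteRankFree V n := by
  choose b hb using exists_mem_finiteRankFree (V := V)
  induction W with
  | nil => exact ⟨0, by simp⟩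
  | cons x W ih =>
    refine ⟨((x :: W).map b).sum, fun y hy => hb y _ ?_⟩
    exact List.single_le_sum (by simp) _ (List.mem_map_of_mem hy)

end FreeAlgebra

/-! ### Presentations of the free algebras of finite rank -/

section Terms

theorem getD_ofFn {n : ℕ} (f : Fin n → ℕ) {i : ℕ} (hi : i < n) :
    (List.ofFn f).getD i 0 = f ⟨i, hi⟩ := by
  rw [List.getD_eq_getElem _ _ (by simpa using hi), List.getElem_ofFn]

variable {L : FirstOrder.Language.{0, 0}} {M N : Type} [L.Structure M] [L.Structure N]

theorem realize_relabel_val {k : ℕ} (t : L.Term (Empty ⊕ Fin k)) (u : ℕ → M) :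
    (t.relabel (Sum.elim Empty.elim Fin.val)).realize u =
      t.realize (Sum.elim Empty.elim fun i : Fin k => u i) := by
  rw [FirstOrder.Language.Term.realize_relabel]
  refine congrArg (fun w => t.realize w) (funext fun x => ?_)
  rcases x with z | x
  · exact z.elim
  · rfl

theorem hom_realize {k : ℕ} (h : M →[L] N) (t : L.Term (Empty ⊕ Fin k)) (w : Fin k → M) :
    h (t.realize (Sum.elim Empty.elim w)) = t.realize (Sum.elim Empty.elim fun i => h (w i)) := by
  rw [← FirstOrder.Language.HomClass.realize_term]
  refine congrArg (fun w => t.realize w) (funext fun x => ?_)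
  rcases x with z | x
  · exact z.elim
  · rfl

end Terms

section Presentations

variable {L : FirstOrder.Language.{0, 0}} [L.IsAlgebraic] [Finite (Σ n, L.Functions n)]
  (e : (Σ n, L.Functions n) ↪ ℕ) (E : List (L.Term ℕ × L.Term ℕ)) (V : Set (Alg L))

/-- The data `a`, `ts`, `v` present the algebra of `V` free on `n + 1` generators: the algebra coded
by `a` belongs to `V`, it is generated by the values listed in `v`, its element `i` is the value of
the term coded by the `i`-th entry of `ts`, and its operation tables, read as equations between
these terms, are derivable from `E`. -/
structure IsPresentation (n a : ℕ) (ts v : List ℕ) : Prop where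
  table : ∀ (k : ℕ) (f : L.Functions k) (xs : Fin k → ℕ), (∀ i, xs i < a.unpair.1 + 1) →
    EqDerivable e E
      (Nat.pair (e ⟨k, f⟩ + 1) (Encodable.encode (List.ofFn fun i => ts.getD (xs i) 0)))
      (ts.getD (tableOp a (e ⟨k, f⟩) (List.ofFn xs)) 0)
  length_eq : v.length = n + 1
  lt_of_mem : ∀ i ∈ v, i < a.unpair.1 + 1
  generator : ∀ i < n + 1, EqDerivable e E (Nat.pair 0 i) (ts.getD (v.getD i 0) 0)
  isTerm : ∀ i < a.unpair.1 + 1, isTermCode (signatureList e) (n + 1) (ts.getD i 0) = true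
  eval : ∀ i < a.unpair.1 + 1, evalCode a v (ts.getD i 0) = i
  mem : tableAlg e a ∈ V

theorem isSigmaOne_table {α : Type} [Primcodable α] {a j : α → ℕ} {ts c : α → List ℕ}
    (ha : Primrec a) (hj : Primrec j) (hts : Primrec ts) (hc : Primrec c) :
    IsSigmaOne fun z => EqDerivable e E
      (Nat.pair (j z + 1) (Encodable.encode ((c z).map fun x => (ts z).getD x 0)))
      ((ts z).getD (tableOp (a z) (j z) (c z)) 0) := by
  refine (isSigmaOne_eqDerivable e E).comp (f := fun z => (_, _)) (Primrec.pair
    (Primrec₂.natPair.comp (Primrec.succ.comp hj) (Primrec.encode.comp (Primrec.list_map hc ?_)))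
    ((Primrec.list_getD 0).comp hts (primrec_tableOp.comp (Primrec.pair ha (Primrec.pair hj hc)))))
  exact (Primrec.list_getD 0).comp (hts.comp Primrec.fst) Primrec.snd

set_option maxHeartbeats 1000000 in
/-- Being a presentation is `Σ₁`. The arguments of the operations range over lists, whose codes are
bounded by `exists_position_bound`. -/
theorem isSigmaOne_isPresentation (hfin : FinitelyAxiomatizable V) :
    IsSigmaOne fun z : ℕ × ℕ × List ℕ × List ℕ =>
      IsPresentation e E V z.1 z.2.1 z.2.2.1 z.2.2.2 := by
  classical
  obtain ⟨B, hB, hB'⟩ := exists_position_bound (signatureList e)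
  obtain ⟨T, hT, rfl⟩ := hfin
  have ha : Primrec fun z : ℕ × ℕ × List ℕ × List ℕ => z.2.1 := Primrec.fst.comp Primrec.snd
  have hN : Primrec fun z : ℕ × ℕ × List ℕ × List ℕ => z.2.1.unpair.1 + 1 :=
    Primrec.succ.comp (Primrec.fst.comp (Primrec.unpair.comp ha))
  have hts : Primrec fun z : ℕ × ℕ × List ℕ × List ℕ => z.2.2.1 :=
    Primrec.fst.comp (Primrec.snd.comp Primrec.snd)
  have hv : Primrec fun z : ℕ × ℕ × List ℕ × List ℕ => z.2.2.2 :=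
    Primrec.snd.comp (Primrec.snd.comp Primrec.snd)
  have hn : Primrec fun z : ℕ × ℕ × List ℕ × List ℕ => z.1 + 1 := Primrec.succ.comp Primrec.fst
  have hget : Primrec fun z : (ℕ × ℕ × List ℕ × List ℕ) × ℕ => z.1.2.2.1.getD z.2 0 :=
    (Primrec.list_getD 0).comp (hts.comp Primrec.fst) Primrec.snd
  have h1 : IsSigmaOne fun z : ℕ × ℕ × List ℕ × List ℕ => ∀ s ∈ signatureList e,
      ∀ c < B z.2.1.unpair.1, ¬ ((decodeList c).length = s.2 ∧
        ∀ x ∈ decodeList c, x < z.2.1.unpair.1 + 1) ∨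
      EqDerivable e E
        (Nat.pair (s.1 + 1) (Encodable.encode ((decodeList c).map fun x => z.2.2.1.getD x 0)))
        (z.2.2.1.getD (tableOp z.2.1 s.1 (decodeList c)) 0) := by
    refine IsSigmaOne.ball (l := fun _ => signatureList e) (IsSigmaOne.ball_lt
      (IsSigmaOne.or (IsSigmaOne.of_primrecPred ?_) ?_) ?_) (Primrec.const _)
    · refine PrimrecPred.not (PrimrecPred.and ?_ ?_)
      · exact Primrec.eq.comp (Primrec.list_length.comp (primrec_decodeList.comp Primrec.snd))
          (Primrec.snd.comp (Primrec.snd.comp Primrec.fst))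
      · exact primrecPred_forall_mem
          (l := fun w : ((ℕ × ℕ × List ℕ × List ℕ) × ℕ × ℕ) × ℕ => decodeList w.2)
          (R := fun w x => x < w.1.1.2.1.unpair.1 + 1) (primrec_decodeList.comp Primrec.snd)
          (Primrec.nat_lt.comp Primrec.snd
            (hN.comp (Primrec.fst.comp (Primrec.fst.comp Primrec.fst))))
    · exact isSigmaOne_table e E (ha.comp (Primrec.fst.comp Primrec.fst))
        (Primrec.fst.comp (Primrec.snd.comp Primrec.fst)) (hts.comp (Primrec.fst.comp Primrec.fst))
        (primrec_decodeList.comp Primrec.snd)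
    · exact hB.comp (Primrec.fst.comp (Primrec.unpair.comp (ha.comp Primrec.fst)))
  have h2 : PrimrecPred fun z : ℕ × ℕ × List ℕ × List ℕ => z.2.2.2.length = z.1 + 1 :=
    Primrec.eq.comp (Primrec.list_length.comp hv) hn
  have h3 : PrimrecPred fun z : ℕ × ℕ × List ℕ × List ℕ =>
      ∀ i ∈ z.2.2.2, i < z.2.1.unpair.1 + 1 :=
    primrecPred_forall_mem (l := fun z : ℕ × ℕ × List ℕ × List ℕ => z.2.2.2)
      (R := fun z i => i < z.2.1.unpair.1 + 1) hv
      (Primrec.nat_lt.comp Primrec.snd (hN.comp Primrec.fst))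
  have h4 : IsSigmaOne fun z : ℕ × ℕ × List ℕ × List ℕ => ∀ i < z.1 + 1,
      EqDerivable e E (Nat.pair 0 i) (z.2.2.1.getD (z.2.2.2.getD i 0) 0) := by
    refine IsSigmaOne.ball_lt ((isSigmaOne_eqDerivable e E).comp
      (f := fun w : (ℕ × ℕ × List ℕ × List ℕ) × ℕ =>
        (Nat.pair 0 w.2, w.1.2.2.1.getD (w.1.2.2.2.getD w.2 0) 0)) ?_) hn
    exact Primrec.pair (Primrec₂.natPair.comp (Primrec.const 0) Primrec.snd)
      (hget.comp (Primrec.pair Primrec.fst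
        ((Primrec.list_getD 0).comp (hv.comp Primrec.fst) Primrec.snd)))
  have h5' : PrimrecPred fun w : (ℕ × ℕ × List ℕ × List ℕ) × ℕ =>
      isTermCode (signatureList e) (w.1.1 + 1) (w.1.2.2.1.getD w.2 0) = true :=
    Primrec.eq.comp ((primrec_isTermCode (signatureList e)).comp
      (Primrec.pair (hn.comp Primrec.fst) hget)) (Primrec.const true)
  have h5 : IsSigmaOne fun z : ℕ × ℕ × List ℕ × List ℕ => ∀ i < z.2.1.unpair.1 + 1,
      isTermCode (signatureList e) (z.1 + 1) (z.2.2.1.getD i 0) = true :=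
    IsSigmaOne.ball_lt (IsSigmaOne.of_primrecPred h5') hN
  have h6' : PrimrecPred fun w : (ℕ × ℕ × List ℕ × List ℕ) × ℕ =>
      evalCode w.1.2.1 w.1.2.2.2 (w.1.2.2.1.getD w.2 0) = w.2 :=
    Primrec.eq.comp (primrec_evalCode.comp (Primrec.pair (Primrec.pair (ha.comp Primrec.fst)
      (hv.comp Primrec.fst)) hget)) Primrec.snd
  have h6 : IsSigmaOne fun z : ℕ × ℕ × List ℕ × List ℕ => ∀ i < z.2.1.unpair.1 + 1,
      evalCode z.2.1 z.2.2.2 (z.2.2.1.getD i 0) = i :=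
    IsSigmaOne.ball_lt (IsSigmaOne.of_primrecPred h6') hN
  have h7 : PrimrecPred fun z : ℕ × ℕ × List ℕ × List ℕ =>
      ∀ c ∈ hT.toFinset.toList.map (formulaCode e), satCode z.2.1 [] c = true :=
    primrecPred_forall_mem (l := fun _ : ℕ × ℕ × List ℕ × List ℕ =>
        hT.toFinset.toList.map (formulaCode e))
      (R := fun z c => satCode z.2.1 [] c = true) (Primrec.const _)
      (Primrec.eq.comp (primrec_satCode.comp (Primrec.pair (Primrec.pair
        (ha.comp Primrec.fst) (Primrec.const [])) Primrec.snd)) (Primrec.const true))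
  refine (h1.and ((IsSigmaOne.of_primrecPred h2).and ((IsSigmaOne.of_primrecPred h3).and
    (h4.and (h5.and (h6.and (IsSigmaOne.of_primrecPred h7))))))).of_eq ?_
  rintro ⟨n, a, ts, v⟩
  have hmem : (∀ c ∈ hT.toFinset.toList.map (formulaCode e), satCode a [] c = true) ↔
      tableAlg e a ∈ modelClass T := by
    simp only [List.forall_mem_map, Finset.mem_toList, Set.Finite.mem_toFinset,
      satCode_sentence]
    rfl
  constructor
  · rintro ⟨h1, h2, h3, h4, h5, h6, h7⟩
    refine ⟨fun k f xs hxs => ?_, h2, h3, h4, h5, h6, hmem.1 h7⟩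
    have hs : (e ⟨k, f⟩, k) ∈ signatureList e := (mem_signatureList e).2 ⟨f, rfl⟩
    have hx : ∀ x ∈ List.ofFn xs, x < a.unpair.1 + 1 := by
      intro x hx
      obtain ⟨i, rfl⟩ := (List.mem_ofFn' _ _).1 hx
      exact hxs i
    have hlt : Encodable.encode (List.ofFn xs) < B a.unpair.1 :=
      (Nat.right_le_pair _ _).trans_lt (hB' _ _ hs _ List.length_ofFn hx)
    rcases h1 _ hs _ hlt with h | h
    · exact absurd ⟨by simp, by simpa using hxs⟩ h
    · simpa [List.map_ofFn, Function.comp_def] using h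
  · intro h
    refine ⟨?_, h.length_eq, h.lt_of_mem, h.generator, h.isTerm, h.eval, hmem.2 h.mem⟩
    rintro ⟨j, k⟩ hs c -
    obtain ⟨f, rfl⟩ := (mem_signatureList e).1 hs
    obtain ⟨l, rfl⟩ : ∃ l, c = Encodable.encode l := ⟨decodeList c, by simp⟩
    rw [decodeList_encode, or_iff_not_imp_left, not_not]
    rintro ⟨rfl, hl⟩
    have := h.table _ f l.get fun i => hl _ (l.get_mem i)
    rw [List.ofFn_get] at this
    have h' : l.map (fun x => ts.getD x 0) = List.ofFn fun i => ts.getD (l.get i) 0 := by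
      conv_lhs => rw [← List.ofFn_get l, List.map_ofFn]
      rfl
    simpa only [h'] using this

variable {e E V}

/-- The terms of a presentation represent all elements of an algebra of `V` generated by `n + 1`
elements. -/
theorem IsPresentation.card_closure_le {n a : ℕ} {ts v : List ℕ} (h : IsPresentation e E V n a ts v)
    {A : Alg L} (hA : ∀ p ∈ E, A.SatEq p.1 p.2) (w : ℕ → A.carrier) :
    Nat.card (FirstOrder.Language.Substructure.closure L (Set.range fun i : Fin (n + 1) => w i)) ≤
      a.unpair.1 + 1 := by
  obtain ⟨g, hg⟩ := exists_hom_codeAlg e A w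
  let val : Fin (a.unpair.1 + 1) → A.carrier := fun i => g (ts.getD i 0 : ℕ)
  let X : L.Substructure A.carrier :=
    { carrier := Set.range val
      fun_mem := by
        intro k f xs hxs
        choose i hi using hxs
        refine ⟨⟨_, tableOp_lt a (e ⟨k, f⟩) (List.ofFn fun j => (i j).val)⟩, ?_⟩
        have := EqDerivable.hom_eq hA g (h.table k f (fun j => (i j).val) fun j => (i j).2)
        refine this.symm.trans ((g.map_fun f fun j => (ts.getD (i j) 0 : ℕ)).trans ?_)
        exact congrArg _ (funext hi) }
  have hle : FirstOrder.Language.Substructure.closure L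
      (Set.range fun i : Fin (n + 1) => w i) ≤ X := by
    rw [FirstOrder.Language.Substructure.closure_le]
    rintro _ ⟨i, rfl⟩
    have hi : v.getD i 0 < a.unpair.1 + 1 := by
      have hi' : (i : ℕ) < v.length := by rw [h.length_eq]; exact i.2
      rw [List.getD_eq_getElem _ _ hi']
      exact h.lt_of_mem _ (List.getElem_mem hi')
    exact ⟨⟨_, hi⟩, (EqDerivable.hom_eq hA g (h.generator i i.2)).symm.trans (hg i)⟩
  calc Nat.card (FirstOrder.Language.Substructure.closure L _)
      ≤ Nat.card (Set.range val) := Nat.card_mono (Set.finite_range val) hle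
    _ ≤ Nat.card (Fin (a.unpair.1 + 1)) := Finite.card_range_le val
    _ = a.unpair.1 + 1 := Nat.card_fin _

/-- The algebra of a presentation is embedded in the free algebra: its elements are the values of
distinct terms, distinct because they already differ in this algebra itself. -/
theorem IsPresentation.exists_embedding (hE : ∀ A : Alg L, A ∈ V ↔ ∀ p ∈ E, A.SatEq p.1 p.2)
    {n a : ℕ} {ts v : List ℕ} (h : IsPresentation e E V n a ts v) :
    Nonempty ((tableAlg e a).carrier ↪[L] (freeAlg V ℕ).carrier) := by
  choose τ hτ using fun i : (tableAlg e a).carrier =>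
    (isTermCode_iff e).1 (h.isTerm (Fin.val i) (Fin.is_lt i))
  let σ : (tableAlg e a).carrier → L.Term ℕ := fun i =>
    (τ i).relabel (Sum.elim Empty.elim Fin.val)
  have hσ : ∀ i, varTermCode e (σ i) = ts.getD (Fin.val i) 0 := fun i =>
    (termCode_eq_varTermCode e (τ i)).symm.trans (hτ i)
  let u : ℕ → (tableAlg e a).carrier := fun i => Fin.ofNat (a.unpair.1 + 1) (v.getD i 0)
  have hv : v = List.ofFn fun i : Fin (n + 1) => Fin.val (u i) := by
    refine List.ext_getElem (by rw [List.length_ofFn, h.length_eq]) fun i hi hi' => ?_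
    rw [List.getElem_ofFn]
    change v[i] = v.getD i 0 % (a.unpair.1 + 1)
    rw [List.getD_eq_getElem _ _ hi, Nat.mod_eq_of_lt (h.lt_of_mem _ (List.getElem_mem hi))]
  have hval : ∀ i, (σ i).realize u = i := by
    intro i
    refine Fin.ext ((congrArg Fin.val (realize_relabel_val (τ i) u)).trans ?_)
    rw [← evalCode_termCode e a (fun i => u i), ← hv, hτ i]
    exact h.eval _ (Fin.is_lt i)
  refine ⟨⟨⟨fun i => Quotient.mk (freeSetoid V ℕ) (σ i), fun i j hij => ?_⟩,
    fun {k} f xs => ?_, fun {k} r => isEmptyElim r⟩⟩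
  · have := (Quotient.exact hij : ∀ A ∈ V, A.SatEq (σ i) (σ j)) _ h.mem u
    exact (hval i).symm.trans (this.trans (hval j))
  · refine Eq.trans (Quotient.sound ?_) (mk_func V f fun i => σ (xs i))
    refine (eqDerivable_varTermCode_iff e E hE _ _).1 (EqDerivable.symm ?_)
    have := h.table k f (fun i => Fin.val (xs i)) fun i => Fin.is_lt _
    simp only [← hσ] at this
    rw [hσ]
    exact this

/-- The free algebras of finite rank have presentations. -/
theorem exists_isPresentation (hE : ∀ A : Alg L, A ∈ V ↔ ∀ p ∈ E, A.SatEq p.1 p.2)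
    (hloc : LocallyFinite V) (n : ℕ) : ∃ a ts v, IsPresentation e E V n a ts v ∧
      Nonempty (finiteRankFree V n ≃[L] (tableAlg e a).carrier) := by
  obtain ⟨B, -, hB⟩ := exists_position_bound (signatureList e)
  have hF := freeAlg_mem hE
  have hfin : Finite (finiteRankFree V n) := hloc _ hF _ (Set.finite_range _)
  have hx : ∀ i : Fin (n + 1), freeGen V i ∈ finiteRankFree V n := fun i =>
    FirstOrder.Language.Substructure.subset_closure ⟨i, rfl⟩
  let x : Fin (n + 1) → finiteRankFree V n := fun i => ⟨freeGen V i, hx i⟩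
  have hne : Nonempty (finiteRankFree V n) := ⟨x 0⟩
  obtain ⟨N, hN⟩ : ∃ N, Nat.card (finiteRankFree V n) = N + 1 :=
    Nat.exists_eq_succ_of_ne_zero Nat.card_pos.ne'
  obtain ⟨t, -, ⟨g⟩⟩ := exists_equiv_tableAlg e hB ⟨finiteRankFree V n⟩
    ((Finite.equivFin _).trans (finCongr hN))
  change finiteRankFree V n ≃[L] _ at g
  generalize Nat.pair N t = a at g
  choose τ hτ using fun i : (tableAlg e a).carrier => exists_term_of_mem_closure_range (g.symm i).2
  let σ : (tableAlg e a).carrier → L.Term ℕ := fun i =>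
    (τ i).relabel (Sum.elim Empty.elim Fin.val)
  have hσ : ∀ i, (Quotient.mk (freeSetoid V ℕ) (σ i) : (freeAlg V ℕ).carrier) =
      (g.symm i).val := fun i =>
    (realize_freeGen V (σ i)).symm.trans ((realize_relabel_val (τ i) _).trans (hτ i))
  let ts : List ℕ := List.ofFn fun i : Fin (a.unpair.1 + 1) => termCode e (τ i)
  have hts : ∀ i : (tableAlg e a).carrier, ts.getD (Fin.val i) 0 = termCode e (τ i) := fun i =>
    getD_ofFn _ (Fin.is_lt i)
  have hts' : ∀ i : (tableAlg e a).carrier, ts.getD (Fin.val i) 0 = varTermCode e (σ i) :=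
    fun i => (hts i).trans (termCode_eq_varTermCode e (τ i))
  refine ⟨a, ts, List.ofFn fun i => Fin.val (g (x i)),
    ⟨fun k f xs hxs => ?_, List.length_ofFn, fun i hi => ?_, fun i hi => ?_, fun i hi => ?_,
      fun i hi => ?_, ?_⟩, ⟨g⟩⟩
  · let ys : Fin k → (tableAlg e a).carrier := fun i => (⟨xs i, hxs i⟩ : Fin (a.unpair.1 + 1))
    let y : (tableAlg e a).carrier := FirstOrder.Language.Structure.funMap f ys
    have h1 := hts' y
    have h2 : (List.ofFn fun i => ts.getD (xs i) 0) =
        List.ofFn fun i => varTermCode e (σ (ys i)) := congrArg _ (funext fun i => hts' (ys i))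
    change EqDerivable e E _ (ts.getD (Fin.val y) 0)
    rw [h1, h2]
    refine (eqDerivable_varTermCode_iff e E hE (.func f fun i => σ (ys i)) _).2 ?_
    have h3 : (Quotient.mk (freeSetoid V ℕ) (.func f fun i => σ (ys i)) : (freeAlg V ℕ).carrier) =
        Quotient.mk (freeSetoid V ℕ) (σ (FirstOrder.Language.Structure.funMap f ys)) := by
      refine (mk_func V f fun i => σ (ys i)).trans (Eq.trans ?_ (hσ _).symm)
      refine Eq.trans ?_ (congrArg Subtype.val (g.symm.map_fun f ys)).symm
      exact congrArg _ (funext fun i => hσ (ys i))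
    exact Quotient.exact h3
  · obtain ⟨i, rfl⟩ := (List.mem_ofFn' _ _).1 hi
    exact Fin.is_lt _
  · rw [getD_ofFn _ hi, hts']
    refine (eqDerivable_varTermCode_iff e E hE (.var i) _).2 ?_
    have h3 : freeGen V i = Quotient.mk (freeSetoid V ℕ) (σ (g (x ⟨i, hi⟩))) :=
      (congrArg Subtype.val (g.symm_apply_apply (x ⟨i, hi⟩))).symm.trans (hσ _).symm
    exact Quotient.exact h3
  · rw [isTermCode_iff]
    exact ⟨_, (hts (⟨i, hi⟩ : Fin (a.unpair.1 + 1))).symm⟩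
  · let i' : (tableAlg e a).carrier := (⟨i, hi⟩ : Fin (a.unpair.1 + 1))
    have h1 : ts.getD i 0 = termCode e (τ i') := hts i'
    have h2 : (τ i').realize (Sum.elim Empty.elim x) = g.symm i' :=
      Subtype.ext ((hom_realize (finiteRankFree V n).subtype.toHom (τ i') x).trans (hτ i'))
    have h3 : (τ i').realize (Sum.elim Empty.elim fun i => g (x i)) = i' :=
      (hom_realize g.toHom (τ i') x).symm.trans ((congrArg g h2).trans (g.apply_symm_apply i'))
    rw [h1, evalCode_termCode e a fun i => g (x i), h3]
  · refine (hE _).2 fun p hp => ?_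
    exact satEq_of_injective ((finiteRankFree V n).subtype.toHom.comp g.symm.toHom)
      (Subtype.val_injective.comp g.symm.injective) ((hE _).1 hF p hp)

end Presentations

/-! ### The universal theory of the free algebra -/

section Decidability

variable {L : FirstOrder.Language.{0, 0}}

theorem primrecPred_isUniversalCode [Finite (Σ n, L.Functions n)] (e : (Σ n, L.Functions n) ↪ ℕ) :
    PrimrecPred fun m : ℕ => isUniversalCode (signatureList e) 0 m = true :=
  Primrec.eq.comp ((primrec_isUniversalCode _).comp
    (Primrec.pair (Primrec.const 0) Primrec.id)) (Primrec.const true)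

theorem primrecPred_satCode : PrimrecPred fun z : ℕ × ℕ => satCode z.1 [] z.2 = true :=
  Primrec.eq.comp (primrec_satCode.comp
    (Primrec.pair (Primrec.pair Primrec.fst (Primrec.const [])) Primrec.snd)) (Primrec.const true)

theorem realize_sentence_of_embedding {M N : Type} [L.Structure M] [L.Structure N]
    {φ : L.Sentence} (hφ : φ.IsUniversal) (f : M ↪[L] N) (h : N ⊨ φ) : M ⊨ φ := by
  rw [realize_sentence_iff (Fin.elim0 : Fin 0 → M)]
  refine hφ.realize_embedding f ?_
  have := (realize_sentence_iff (f ∘ (Fin.elim0 : Fin 0 → M))).1 h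
  convert this using 1

variable [L.IsAlgebraic] {V : Set (Alg L)}

theorem mem_univTheory_freeAlg {φ : L.Sentence} :
    φ ∈ univTheory {freeAlg V ℕ} ↔ φ.IsUniversal ∧ (freeAlg V ℕ).carrier ⊨ φ := by
  simp [univTheory]

variable [Finite (Σ n, L.Functions n)] {e : (Σ n, L.Functions n) ↪ ℕ}
  {E : List (L.Term ℕ × L.Term ℕ)}

theorem isUniversalCode_iff_sentence {m : ℕ} : isUniversalCode (signatureList e) 0 m = true ↔
    ∃ φ : L.Sentence, φ.IsUniversal ∧ formulaCode e φ = m :=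
  isUniversalCode_iff e

/-- A universal sentence fails in the free algebra exactly if it fails in one of finite rank. -/
theorem notMem_univTheory_code_iff (hE : ∀ A : Alg L, A ∈ V ↔ ∀ p ∈ E, A.SatEq p.1 p.2)
    (hloc : LocallyFinite V) (m : ℕ) :
    (¬ ∃ φ ∈ univTheory {freeAlg V ℕ}, formulaCode e φ = m) ↔
      ¬ isUniversalCode (signatureList e) 0 m = true ∨
      ∃ z : ℕ × ℕ × List ℕ × List ℕ, IsPresentation e E V z.1 z.2.1 z.2.2.1 z.2.2.2 ∧
        ¬ satCode z.2.1 [] m = true := by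
  constructor
  · intro h
    rw [or_iff_not_imp_left, not_not, isUniversalCode_iff_sentence]
    rintro ⟨φ, hφ, rfl⟩
    have hF : ¬ (freeAlg V ℕ).carrier ⊨ φ := fun hF =>
      h ⟨φ, mem_univTheory_freeAlg.2 ⟨hφ, hF⟩, rfl⟩
    rw [realize_sentence_iff Fin.elim0] at hF
    obtain ⟨W, -, hW⟩ := exists_witnesses e hφ _ hF
    obtain ⟨n, hn⟩ := exists_forall_mem_finiteRankFree W
    obtain ⟨a, ts, v, hp, ⟨g⟩⟩ := exists_isPresentation (e := e) hE hloc n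
    refine ⟨(n, a, ts, v), hp, ?_⟩
    rw [satCode_sentence]
    intro ha
    refine hW _ hn Fin.elim0 (fun i => i.elim0) ((realize_sentence_iff _).1 ?_)
    exact realize_sentence_of_embedding hφ g.toEmbedding ha
  · rintro (h | ⟨z, hz, hsat⟩) ⟨φ, hφ, rfl⟩
    · exact h (isUniversalCode_iff_sentence.2 ⟨φ, hφ.1, rfl⟩)
    · rw [satCode_sentence] at hsat
      obtain ⟨f⟩ := hz.exists_embedding hE
      exact hsat (realize_sentence_of_embedding hφ.1 f (mem_univTheory_freeAlg.1 hφ).2)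

/-- A universal sentence with code `m` has at most `m` quantifiers. Hence it holds in the free
algebra exactly if it holds in all models of the axioms `S` that have at most as many elements as
the free algebra of rank `m + 1`; each of the remaining algebras of that size violates an axiom. -/
theorem mem_univTheory_code_iff (hE : ∀ A : Alg L, A ∈ V ↔ ∀ p ∈ E, A.SatEq p.1 p.2)
    (hloc : LocallyFinite V) {S : Set L.Sentence}
    (hS : modelClass S = modelClass (univTheory {freeAlg V ℕ})) {B : ℕ → ℕ}
    (hB : ∀ (N : ℕ), ∀ s ∈ signatureList e, ∀ l : List ℕ, l.length = s.2 →
      (∀ x ∈ l, x < N + 1) → Nat.pair s.1 (Encodable.encode l) < B N) (m : ℕ) :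
    (∃ φ ∈ univTheory {freeAlg V ℕ}, formulaCode e φ = m) ↔
      isUniversalCode (signatureList e) 0 m = true ∧
      ∃ y : ℕ × List ℕ × List ℕ, IsPresentation e E V m y.1 y.2.1 y.2.2 ∧
        ∀ N < y.1.unpair.1 + 1, ∀ t < (N + 1) ^ B N, satCode (Nat.pair N t) [] m = true ∨
          ∃ s, (∃ ψ ∈ S, formulaCode e ψ = s) ∧ ¬ satCode (Nat.pair N t) [] s = true := by
  constructor
  · rintro ⟨φ, hφ, rfl⟩
    refine ⟨isUniversalCode_iff_sentence.2 ⟨φ, hφ.1, rfl⟩, ?_⟩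
    obtain ⟨a, ts, v, hp, -⟩ := exists_isPresentation (e := e) hE hloc (formulaCode e φ)
    refine ⟨(a, ts, v), hp, fun N _ t _ => ?_⟩
    rw [or_iff_not_imp_left, satCode_sentence]
    intro hsat
    have : tableAlg e (Nat.pair N t) ∉ modelClass S := by
      rw [hS]
      exact fun h => hsat (h φ hφ)
    change ¬ ∀ ψ ∈ S, (tableAlg e (Nat.pair N t)).carrier ⊨ ψ at this
    push Not at this
    obtain ⟨ψ, hψ, h⟩ := this
    exact ⟨_, ⟨ψ, hψ, rfl⟩, by rwa [satCode_sentence]⟩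
  · rintro ⟨h, ⟨a, ts, v⟩, hp, hall⟩
    obtain ⟨φ, hφ, rfl⟩ := isUniversalCode_iff_sentence.1 h
    refine ⟨φ, mem_univTheory_freeAlg.2 ⟨hφ, ?_⟩, rfl⟩
    by_contra hF
    rw [realize_sentence_iff Fin.elim0] at hF
    obtain ⟨W, hlen, hW⟩ := exists_witnesses e hφ _ hF
    -- The witnesses of the failure, padded to `m + 1` elements, generate a finite subalgebra `K`
    -- in which the sentence still fails.
    let w : ℕ → (freeAlg V ℕ).carrier := fun i => W.getD i (freeGen V 0)
    let K := FirstOrder.Language.Substructure.closure L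
      (Set.range fun i : Fin (formulaCode e φ + 1) => w i)
    have hK : ∀ i : Fin (formulaCode e φ + 1), w i ∈ K := fun i =>
      FirstOrder.Language.Substructure.subset_closure ⟨i, rfl⟩
    have hWK : ∀ x ∈ W, x ∈ K := by
      intro x hx
      obtain ⟨i, hi, rfl⟩ := List.getElem_of_mem hx
      have := hK ⟨i, by omega⟩
      simpa [w, hi] using this
    have hFV := freeAlg_mem hE
    have hfin : Finite K := hloc _ hFV _ (Set.finite_range _)
    have hne : Nonempty K := ⟨⟨_, hK 0⟩⟩
    have hcard : Nat.card K ≤ a.unpair.1 + 1 := hp.card_closure_le ((hE _).1 hFV) w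
    obtain ⟨N, hN⟩ : ∃ N, Nat.card K = N + 1 := Nat.exists_eq_succ_of_ne_zero Nat.card_pos.ne'
    obtain ⟨t, ht, ⟨g⟩⟩ := exists_equiv_tableAlg e hB ⟨K⟩ ((Finite.equivFin _).trans (finCongr hN))
    change K ≃[L] _ at g
    rcases hall N (by simp only; omega) t ht with h | ⟨_, ⟨ψ, hψ, rfl⟩, h⟩
    · rw [satCode_sentence] at h
      exact hW K hWK Fin.elim0 (fun i => i.elim0) ((realize_sentence_iff _).1
        (realize_sentence_of_embedding hφ g.toEmbedding h))
    -- `K` is a model of the universal theory of the free algebra, hence violates no axiom.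
    · have hKS : (⟨K⟩ : Alg L) ∈ modelClass S := by
        rw [hS]
        exact fun χ hχ => realize_sentence_of_embedding hχ.1 K.subtype
          (mem_univTheory_freeAlg.1 hχ).2
      rw [satCode_sentence] at h
      exact h ((FirstOrder.Language.StrongHomClass.realize_sentence g ψ).1 (hKS ψ hψ))

theorem isSigmaOne_notMem_univTheory (hE : ∀ A : Alg L, A ∈ V ↔ ∀ p ∈ E, A.SatEq p.1 p.2)
    (hfin : FinitelyAxiomatizable V) (hloc : LocallyFinite V) :
    IsSigmaOne fun m : ℕ => ¬ ∃ φ ∈ univTheory {freeAlg V ℕ}, formulaCode e φ = m := by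
  refine IsSigmaOne.of_eq ?_ fun m => (notMem_univTheory_code_iff hE hloc m).symm
  refine (IsSigmaOne.of_primrecPred (primrecPred_isUniversalCode e).not).or (IsSigmaOne.ex
    (((isSigmaOne_isPresentation e E V hfin).comp Primrec.snd).and
      (IsSigmaOne.of_primrecPred ?_)))
  exact (primrecPred_satCode.comp (f := fun w : ℕ × ℕ × ℕ × List ℕ × List ℕ => (w.2.2.1, w.1))
    (Primrec.pair (Primrec.fst.comp (Primrec.snd.comp Primrec.snd)) Primrec.fst)).not

theorem isSigmaOne_mem_univTheory (hE : ∀ A : Alg L, A ∈ V ↔ ∀ p ∈ E, A.SatEq p.1 p.2)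
    (hfin : FinitelyAxiomatizable V) (hloc : LocallyFinite V)
    (hrec : RecursivelyAxiomatizable e (univTheory {freeAlg V ℕ})) :
    IsSigmaOne fun m : ℕ => ∃ φ ∈ univTheory {freeAlg V ℕ}, formulaCode e φ = m := by
  obtain ⟨S, hS, hSV⟩ := hrec
  obtain ⟨B, hB, hB'⟩ := exists_position_bound (signatureList e)
  have hviol : IsSigmaOne fun a : ℕ =>
      ∃ s, (∃ ψ ∈ S, formulaCode e ψ = s) ∧ ¬ satCode a [] s = true :=
    IsSigmaOne.ex (((IsSigmaOne.of_computablePred hS).comp Primrec.snd).and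
      (IsSigmaOne.of_primrecPred primrecPred_satCode.not))
  have hcheck : IsSigmaOne fun z : ℕ × ℕ => satCode z.1 [] z.2 = true ∨
      ∃ s, (∃ ψ ∈ S, formulaCode e ψ = s) ∧ ¬ satCode z.1 [] s = true :=
    (IsSigmaOne.of_primrecPred primrecPred_satCode).or (hviol.comp Primrec.fst)
  refine IsSigmaOne.of_eq ?_ fun m => (mem_univTheory_code_iff hE hloc hSV hB' m).symm
  refine (IsSigmaOne.of_primrecPred (primrecPred_isUniversalCode e)).and (IsSigmaOne.ex
    (IsSigmaOne.and ((isSigmaOne_isPresentation e E V hfin).comp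
      (f := fun w : ℕ × ℕ × List ℕ × List ℕ => w) Primrec.id) ?_))
  refine IsSigmaOne.ball_lt (IsSigmaOne.ball_lt (hcheck.comp
    (f := fun w : ((ℕ × ℕ × List ℕ × List ℕ) × ℕ) × ℕ => (Nat.pair w.1.2 w.2, w.1.1.1)) ?_) ?_) ?_
  · exact Primrec.pair (Primrec₂.natPair.comp (Primrec.snd.comp Primrec.fst) Primrec.snd)
      (Primrec.fst.comp (Primrec.fst.comp Primrec.fst))
  · exact (Primrec₂.unpaired'.1 Nat.Primrec.pow).comp (Primrec.succ.comp Primrec.snd)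
      (hB.comp Primrec.snd)
  · exact Primrec.succ.comp (Primrec.fst.comp (Primrec.unpair.comp
      (Primrec.fst.comp Primrec.snd)))

end Decidability

end UnivAlg

theorem mainTheorem9 (L : FirstOrder.Language.{0, 0}) [L.IsAlgebraic]
    [Finite (Σ n, L.Functions n)] (e : (Σ n, L.Functions n) ↪ ℕ)
    (V : Set (UnivAlg.Alg L)) (hV : UnivAlg.IsVariety V)
    (hfin : UnivAlg.FinitelyAxiomatizable V) (hloc : UnivAlg.LocallyFinite V)
    (hrec : UnivAlg.RecursivelyAxiomatizable e (UnivAlg.univTheory {UnivAlg.freeAlg V ℕ})) :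
    UnivAlg.DecidableSet e (UnivAlg.univTheory {UnivAlg.freeAlg V ℕ}) := by
  obtain ⟨E, hE⟩ := UnivAlg.exists_finite_basis hV hfin
  exact ComputablePred.computable_iff_re_compl_re'.2
    ⟨(UnivAlg.isSigmaOne_mem_univTheory hE hfin hloc hrec).rePred,
      (UnivAlg.isSigmaOne_notMem_univTheory hE hfin hloc).rePred⟩
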